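/- Setting. Let $\Sigma$ be a Hausdorff space (e.g. a manifold) with a class of admissible compact simple arcs and a group $\mathrm{Diff}$ of homeomorphisms of $\Sigma$ mapping admissible arcs to admissible arcs, such that sub-arcs of admissible arcs are admissible and two admissible arcs intersect in finitely many points and finitely many arcs (e.g. analytic arcs and analytic diffeomorphisms of an analytic manifold). An edge is an oriented admissible arc; a graph $\gamma$ is a finite set of edges that pairwise meet at most in common endpoints, $V(\gamma)$ is the set of these endpoints, $|\gamma|\subset\Sigma$ is the union of the edges, and $\alpha\subseteq\gamma$ means that $\alpha$ is a subset of the edges. Let $G$ be a compact second countable Hausdorff group (e.g. $SU(2)$ or $U(1)^3$), $\overline{\mathcal A}$ the space of generalized $G$-connections (assignments $A$ of holonomies to edges, multiplicative under composition and inversion of edges), and $\mu$ the Ashtekar–Lewandowski measure on $\overline{\mathcal A}$, for which the holonomies along the edges of any graph are independent and Haar distributed. $\mathrm{Diff}$ acts on $L^2(\overline{\mathcal A},\mu)$ by $(U_\varphi f)(A)=f(\varphi^*A)$, where $(\varphi^*A)(e)=A(\varphi(e))$. Let $\mathcal H_\gamma$ be the closure in $L^2(\overline{\mathcal A},\mu)$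 of the gauge invariant continuous functions of the holonomies along the edges of $\gamma$, $\mathcal H'_\gamma$ the orthogonal complement in $\mathcal H_\gamma$ of all $\mathcal H_\beta$ with $\beta\subsetneq\gamma$, and $P'_\gamma$ the orthogonal projector onto $\mathcal H'_\gamma$. Let $\mathrm{Diff}_\gamma$ be the group of $\varphi\in\mathrm{Diff}$ mapping every edge of $\gamma$ onto an edge of $\gamma$ up to orientation, $\mathrm{TDiff}_\gamma\subseteq\mathrm{Diff}_\gamma$ the normal subgroup of those preserving every edge with its orientation, and $\mathrm{GS}_\gamma=\mathrm{Diff}_\gamma/\mathrm{TDiff}_\gamma$ the finite group of graph symmetries. $\mathcal H_{\mathrm{diff}}$ denotes the space of $\mathrm{Diff}$-invariant linear functionals on the linear span $\mathcal C$ of all the spaces $\mathcal H_\gamma$, and the rigging map is defined for $\Psi\in\mathcal H'_\gamma$ by $$(\eta(\Psi)|f\rangle=\sum_{[\varphi]\in\mathrm{Diff}/\mathrm{Diff}_\gamma}\frac1{|\mathrm{GS}_\gamma|}\sum_{g\in\mathrm{GS}_\gamma}\langle U_\varphi U_g\Psi,f\rangle .$$ Hamilton constraints. Let $\hat H(N)$,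 $N:\Sigma\to\mathbb R$, be a family of linear operators on a common domain $\mathcal D\subseteq L^2(\overline{\mathcal A},\mu)$ such that $\mathcal D\cap\mathcal H_\gamma$ is dense in $\mathcal H_\gamma$ for every graph $\gamma$, which is graph preserving, $\hat H(N)(\mathcal D\cap\mathcal H_\gamma)\subseteq\mathcal H_\gamma$, and is a sum over vertices: $\hat H(N)f=\sum_{v\in V(\gamma)}N(v)\hat H_vf$ for $f\in\mathcal D\cap\mathcal H_\gamma$, where $\hat H_v=\hat H(\delta_v)$ and $\delta_v$ is the Kronecker delta at $v$. Proposition. Let $\gamma_0$ be a graph such that 1. for every $\alpha\subseteq\gamma_0$, every element of $\mathrm{GS}_\alpha$ is represented by some $g\in\mathrm{Diff}_{\gamma_0}\cap\mathrm{Diff}_\alpha$ (every symmetry of a subgraph is realized by a symmetry of $\gamma_0$); 2. for every $\alpha\subseteq\gamma_0$, every class $[\varphi]\in\mathrm{Diff}/\mathrm{Diff}_\alpha$ that embeds $\alpha$ into $\gamma_0$, i.e. with $\varphi(|\alpha|)=|\beta|$ for some $\beta\subseteq\gamma_0$, contains an element of $\mathrm{Diff}_{\gamma_0}$. Let $n(\alpha,\gamma_0)$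 be the number of classes $[\varphi]\in\mathrm{Diff}/\mathrm{Diff}_\alpha$ that embed $\alpha$ into $\gamma_0$. Suppose that $\hat H$ is covariant under $\mathrm{GS}_{\gamma_0}$: for all $\varphi\in\mathrm{Diff}_{\gamma_0}$ and $v\in V(\gamma_0)$, $U_\varphi$ maps $\mathcal D\cap\mathcal H_{\gamma_0}$ into $\mathcal D$ and $U_\varphi\hat H_vf=\hat H_{\varphi(v)}U_\varphi f$ for $f\in\mathcal D\cap\mathcal H_{\gamma_0}$. Let $\widetilde\Psi\in\mathcal H_{\gamma_0}$ be in the domain of $$\hat{\mathcal Q}_{\hat H}=\sum_{v\in V(\gamma_0)}\hat H_v|_{\mathcal H_{\gamma_0}}\,\hat H_v|_{\mathcal H_{\gamma_0}}^\dagger$$ (adjoints taken in $\mathcal H_{\gamma_0}$) with $\langle\widetilde\Psi,\hat{\mathcal Q}_{\hat H}\widetilde\Psi\rangle=0$. Then for every $\alpha\subseteq\gamma_0$ the sum defining $(\eta(P'_\alpha\widetilde\Psi)|f\rangle$ converges for every $f\in\mathcal C$, $\eta(P'_\alpha\widetilde\Psi)\in\mathcal H_{\mathrm{diff}}$, and the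 diffeomorphism invariant state $$|\Psi)=\sum_{\alpha\subseteq\gamma_0}\frac1{n(\alpha,\gamma_0)}\,|\eta(P'_\alpha\widetilde\Psi))\in\mathcal H_{\mathrm{diff}}$$ satisfies $(\Psi|\hat H(N)f\rangle=0$ for all $N:\Sigma\to\mathbb R$ and all $f\in\mathcal D\cap\mathcal H_{\gamma_0}$. -/

import Mathlib

open MeasureTheory Set

namespace LQG

section Arcs

variable {S : Type*} [TopologicalSpace S]

/-- `K` is a (compact, simple) arc in `S` running from `x` to `y`. -/
def ArcFromTo (K : Set S) (x y : S) : Prop :=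
  ∃ (f : ℝ → S) (a b : ℝ), a < b ∧ ContinuousOn f (Icc a b) ∧ InjOn f (Icc a b) ∧
    f '' Icc a b = K ∧ f a = x ∧ f b = y

/-- `K` is a compact simple arc in `S`. -/
def IsArc (K : Set S) : Prop := ∃ x y, ArcFromTo K x y

theorem ArcFromTo.symm {K : Set S} {x y : S} (h : ArcFromTo K x y) : ArcFromTo K y x := by
  obtain ⟨f, a, b, hab, hc, hi, hK, rfl, rfl⟩ := h
  have hm : MapsTo (fun t : ℝ => -t) (Icc (-b) (-a)) (Icc a b) := fun t ht =>
    ⟨by linarith [ht.2], by linarith [ht.1]⟩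
  refine ⟨fun t => f (-t), -b, -a, by linarith, hc.comp continuous_neg.continuousOn hm, ?_, ?_,
    by simp, by simp⟩
  · intro s hs t ht hst
    exact neg_injective (hi (hm hs) (hm ht) hst)
  · rw [← hK]
    ext z
    constructor
    · rintro ⟨t, ht, rfl⟩
      exact ⟨-t, hm ht, rfl⟩
    · rintro ⟨t, ht, rfl⟩
      exact ⟨-t, ⟨by linarith [ht.2], by linarith [ht.1]⟩, by simp⟩

theorem ArcFromTo.left_mem {K : Set S} {x y : S} (h : ArcFromTo K x y) : x ∈ K := by
  obtain ⟨f, a, b, hab, hc, hi, rfl, rfl, rfl⟩ := h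
  exact ⟨a, left_mem_Icc.2 hab.le, rfl⟩

theorem ArcFromTo.image {K : Set S} {x y : S} (h : ArcFromTo K x y) (φ : S ≃ₜ S) :
    ArcFromTo (φ '' K) (φ x) (φ y) := by
  obtain ⟨f, a, b, hab, hc, hi, rfl, rfl, rfl⟩ := h
  exact ⟨φ ∘ f, a, b, hab, φ.continuous.comp_continuousOn hc, φ.injective.comp_injOn hi,
    image_comp _ _ _, rfl, rfl⟩

theorem ArcFromTo.exists_interval [T2Space S] {f : ℝ → S} {a b : ℝ}
    (hc : ContinuousOn f (Icc a b)) (hi : InjOn f (Icc a b)) {L : Set S} {x y : S}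
    (h : ArcFromTo L x y) (hL : L ⊆ f '' Icc a b) :
    ∃ c d, a ≤ c ∧ c < d ∧ d ≤ b ∧ L = f '' Icc c d ∧
      ((x = f c ∧ y = f d) ∨ (x = f d ∧ y = f c)) := by
  obtain ⟨g, c, d, hcd, gc, gi, rfl, rfl, rfl⟩ := h
  have hex : ∀ t : Icc c d, ∃ s : Icc a b, f s = g t := fun t => by
    obtain ⟨s, hs, e⟩ := hL ⟨t, t.2, rfl⟩
    exact ⟨⟨s, hs⟩, e⟩
  choose i hi' using hex
  have hF : Topology.IsClosedEmbedding ((Icc a b).domRestrict f) :=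
    (continuousOn_iff_continuous_domRestrict.1 hc).isClosedEmbedding (injOn_iff_injective.1 hi)
  have ic : Continuous i := by
    rw [hF.isEmbedding.continuous_iff]
    have : (Icc a b).domRestrict f ∘ i = (Icc c d).domRestrict g := by
      funext t; exact hi' t
    rw [this]
    exact continuousOn_iff_continuous_domRestrict.1 gc
  let h : ℝ → ℝ := fun t => if ht : t ∈ Icc c d then (i ⟨t, ht⟩ : ℝ) else 0
  have hval : ∀ t (ht : t ∈ Icc c d), h t = i ⟨t, ht⟩ := fun t ht => dif_pos ht
  have hmem : ∀ t ∈ Icc c d, h t ∈ Icc a b := fun t ht => by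
    rw [hval t ht]; exact (i ⟨t, ht⟩).2
  have hfg : ∀ t ∈ Icc c d, f (h t) = g t := fun t ht => by
    rw [hval t ht]; exact hi' ⟨t, ht⟩
  have hcont : ContinuousOn h (Icc c d) := by
    rw [continuousOn_iff_continuous_domRestrict]
    have : (Icc c d).domRestrict h = fun t => (i t : ℝ) := by
      funext t; exact hval t t.2
    rw [this]
    exact continuous_subtype_val.comp ic
  have hinj : InjOn h (Icc c d) := by
    intro s hs t ht hst
    apply gi hs ht
    rw [← hfg s hs, ← hfg t ht, hst]
  have himg : g '' Icc c d = f '' (h '' Icc c d) := by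
    rw [← image_comp]
    exact image_congr fun t ht => (hfg t ht).symm
  have cm : c ∈ Icc c d := left_mem_Icc.2 hcd.le
  have dm : d ∈ Icc c d := right_mem_Icc.2 hcd.le
  rcases hcont.strictMonoOn_of_injOn_Icc' hcd.le hinj with hm | hm
  · refine ⟨h c, h d, (hmem c cm).1, hm cm dm hcd, (hmem d dm).2, ?_, Or.inl ?_⟩
    · rw [himg, hcont.image_Icc_of_monotoneOn hcd.le hm.monotoneOn]
    · exact ⟨(hfg c cm).symm, (hfg d dm).symm⟩
  · refine ⟨h d, h c, (hmem d dm).1, hm cm dm hcd, (hmem c cm).2, ?_, Or.inr ?_⟩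
    · rw [himg, hcont.image_Icc_of_antitoneOn hcd.le hm.antitoneOn]
    · exact ⟨(hfg c cm).symm, (hfg d dm).symm⟩

/-- Two sub-arcs of an arc with the same endpoints agree. -/
theorem ArcFromTo.unique [T2Space S] {E : Set S} (hE : IsArc E) {k l : Set S} {x y : S}
    (hk : ArcFromTo k x y) (hl : ArcFromTo l x y) (hkE : k ⊆ E) (hlE : l ⊆ E) : k = l := by
  obtain ⟨_, _, f, a, b, hab, hc, hi, rfl, rfl, rfl⟩ := hE
  obtain ⟨c, d, hac, hcd, hdb, rfl, h⟩ := hk.exists_interval hc hi hkE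
  obtain ⟨c', d', hac', hcd', hdb', rfl, h'⟩ := hl.exists_interval hc hi hlE
  have e : ∀ s t, a ≤ s → s ≤ b → a ≤ t → t ≤ b → f s = f t → s = t := fun s t h1 h2 h3 h4 h5 =>
    hi ⟨h1, h2⟩ ⟨h3, h4⟩ h5
  have : c = c' ∧ d = d' := by
    rcases h with ⟨h1, h2⟩ | ⟨h1, h2⟩ <;> rcases h' with ⟨h3, h4⟩ | ⟨h3, h4⟩
    · exact ⟨e _ _ (by linarith) (by linarith) (by linarith) (by linarith) (h1.symm.trans h3),
        e _ _ (by linarith) (by linarith) (by linarith) (by linarith) (h2.symm.trans h4)⟩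
    · have e1 := e c d' (by linarith) (by linarith) (by linarith) (by linarith) (h1.symm.trans h3)
      have e2 := e d c' (by linarith) (by linarith) (by linarith) (by linarith) (h2.symm.trans h4)
      linarith
    · have e1 := e d c' (by linarith) (by linarith) (by linarith) (by linarith) (h1.symm.trans h3)
      have e2 := e c d' (by linarith) (by linarith) (by linarith) (by linarith) (h2.symm.trans h4)
      linarith
    · exact ⟨e _ _ (by linarith) (by linarith) (by linarith) (by linarith) (h2.symm.trans h4),
        e _ _ (by linarith) (by linarith) (by linarith) (by linarith) (h1.symm.trans h3)⟩
  rw [this.1, this.2]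

/-- The endpoints of an arc are determined up to order. -/
theorem ArcFromTo.endpoints [T2Space S] {k : Set S} {x y x' y' : S}
    (hk : ArcFromTo k x y) (hl : ArcFromTo k x' y') :
    (x' = x ∧ y' = y) ∨ (x' = y ∧ y' = x) := by
  obtain ⟨f, a, b, hab, hc, hi, rfl, rfl, rfl⟩ := hk
  obtain ⟨c, d, hac, hcd, hdb, hcar, h⟩ := hl.exists_interval hc hi Subset.rfl
  have hIcc : Icc a b ⊆ Icc c d := by
    intro t ht
    obtain ⟨s, hs, e⟩ := hcar.subset ⟨t, ht, rfl⟩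
    rwa [← hi ⟨hac.trans hs.1, hs.2.trans hdb⟩ ht e]
  have h1 := hIcc (left_mem_Icc.2 hab.le)
  have h2 := hIcc (right_mem_Icc.2 hab.le)
  have e1 : c = a := le_antisymm h1.1 hac
  have e2 : d = b := le_antisymm hdb h2.2
  subst e1 e2
  exact h

/-- A sub-arc `k` of `E` that contains no point of `P` in its interior is contained in every
sub-arc of `E` with endpoints in `P` that meets `k` outside `P`. -/
theorem ArcFromTo.piece_subset [T2Space S] {E : Set S} (hE : IsArc E) {P k M : Set S}
    {x y u v z : S} (hk : ArcFromTo k x y) (hM : ArcFromTo M u v) (hkE : k ⊆ E) (hME : M ⊆ E)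
    (hkP : k ∩ P ⊆ {x, y}) (hu : u ∈ P) (hv : v ∈ P) (hzk : z ∈ k) (hzM : z ∈ M) (hzP : z ∉ P) :
    k ⊆ M := by
  obtain ⟨_, _, f, a, b, hab, hc, hi, rfl, rfl, rfl⟩ := hE
  obtain ⟨c, d, hac, hcd, hdb, rfl, h⟩ := hk.exists_interval hc hi hkE
  obtain ⟨c', d', hac', hcd', hdb', rfl, h'⟩ := hM.exists_interval hc hi hME
  have hcP : f c' ∈ P ∧ f d' ∈ P := by
    rcases h' with ⟨h1, h2⟩ | ⟨h1, h2⟩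
    · exact ⟨h1 ▸ hu, h2 ▸ hv⟩
    · exact ⟨h2 ▸ hv, h1 ▸ hu⟩
  obtain ⟨t, ht, rfl⟩ := hzk
  obtain ⟨s, hs, hst⟩ := hzM
  have e : s = t := hi ⟨hac'.trans hs.1, hs.2.trans hdb'⟩ ⟨hac.trans ht.1, ht.2.trans hdb⟩ hst
  subst e
  have key : ∀ r, f r ∈ P → c < r → r < d → False := by
    intro r hr h1 h2
    have hr' : f r = f c ∨ f r = f d := by
      have := hkP ⟨⟨r, ⟨h1.le, h2.le⟩, rfl⟩, hr⟩
      rcases h with ⟨rfl, rfl⟩ | ⟨rfl, rfl⟩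
      · exact this
      · exact this.symm
    rcases hr' with hr' | hr'
    · exact h1.ne' (hi ⟨by linarith, by linarith⟩ ⟨by linarith, by linarith⟩ hr')
    · exact h2.ne (hi ⟨by linarith, by linarith⟩ ⟨by linarith, by linarith⟩ hr')
  have hsc : s ≠ c' := fun h => hzP (h ▸ hcP.1)
  have hsd : s ≠ d' := fun h => hzP (h ▸ hcP.2)
  have h1 : c' ≤ c := by
    by_contra hlt
    exact key c' hcP.1 (not_le.1 hlt) (lt_of_lt_of_le (lt_of_le_of_ne hs.1 hsc.symm) ht.2)
  have h2 : d ≤ d' := by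
    by_contra hlt
    exact key d' hcP.2 (lt_of_le_of_lt ht.1 (lt_of_le_of_ne hs.2 hsd)) (not_le.1 hlt)
  exact image_mono (Icc_subset_Icc h1 h2)

/-- Cutting an arc at an interior point. -/
theorem ArcFromTo.cut {K : Set S} {x y z : S} (h : ArcFromTo K x y) (hz : z ∈ K) (hx : z ≠ x)
    (hy : z ≠ y) : ∃ K₁ K₂, ArcFromTo K₁ x z ∧ ArcFromTo K₂ z y ∧ K₁ ∩ K₂ = {z} ∧
      K = K₁ ∪ K₂ ∧ y ∉ K₁ ∧ x ∉ K₂ := by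
  obtain ⟨f, a, b, hab, hc, hi, rfl, rfl, rfl⟩ := h
  obtain ⟨t, ht, rfl⟩ := hz
  have hat : a < t := lt_of_le_of_ne ht.1 fun h => hx (h ▸ rfl)
  have htb : t < b := lt_of_le_of_ne ht.2 fun h => hy (h ▸ rfl)
  have s1 : Icc a t ⊆ Icc a b := Icc_subset_Icc le_rfl ht.2
  have s2 : Icc t b ⊆ Icc a b := Icc_subset_Icc ht.1 le_rfl
  refine ⟨f '' Icc a t, f '' Icc t b, ⟨f, a, t, hat, hc.mono s1, hi.mono s1, rfl, rfl, rfl⟩,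
    ⟨f, t, b, htb, hc.mono s2, hi.mono s2, rfl, rfl, rfl⟩, ?_, ?_, ?_, ?_⟩
  · rw [← hi.image_inter s1 s2, Icc_inter_Icc_eq_singleton hat.le htb.le, image_singleton]
  · rw [← image_union, Icc_union_Icc_eq_Icc hat.le htb.le]
  · rintro ⟨s, hs, e⟩
    have := hi (s1 hs) (right_mem_Icc.2 hab.le) e
    linarith [hs.2]
  · rintro ⟨s, hs, e⟩
    have := hi (s2 hs) (left_mem_Icc.2 hab.le) e
    linarith [hs.1]

end Arcs

/-- The category of embedded graphs and diffeomorphisms that is considered on the space `S`: a class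
of admissible arcs and a group of admissible homeomorphisms, called diffeomorphisms. Sub-arcs of
admissible arcs are admissible, two admissible arcs intersect in finitely many points and finitely
many arcs, and the group maps admissible arcs to admissible arcs. Typical examples: analytic (or
semianalytic) arcs in an analytic manifold with the analytic (or semianalytic) diffeomorphisms;
straight segments in `ℝⁿ` with the affine maps. -/
structure EdgeCategory (S : Type*) [TopologicalSpace S] where
  arcs : Set (Set S)
  isArc : ∀ K ∈ arcs, IsArc K
  subarc : ∀ K ∈ arcs, ∀ L ⊆ K, IsArc L → L ∈ arcs
  inter : ∀ K ∈ arcs, ∀ L ∈ arcs, ∃ (F : Set S) (M : Set (Set S)), F.Finite ∧ M.Finite ∧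
    (∀ m ∈ M, IsArc m) ∧ K ∩ L = F ∪ ⋃₀ M
  diff : Subgroup (S ≃ₜ S)
  image_mem : ∀ φ ∈ diff, ∀ K ∈ arcs, φ '' K ∈ arcs

variable {S : Type*} [TopologicalSpace S] {C : EdgeCategory S}

/-- An edge: an admissible arc with an orientation, i.e. with a source and a target. -/
@[ext] structure Edge (C : EdgeCategory S) where
  carrier : Set S
  src : S
  tgt : S
  mem : carrier ∈ C.arcs
  arc : ArcFromTo carrier src tgt

namespace Edge

/-- The same arc with the opposite orientation. -/
def rev (e : Edge C) : Edge C := ⟨e.carrier, e.tgt, e.src, e.mem, e.arc.symm⟩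

/-- `e` is the composition of the edges `e₁` (first) and `e₂` (second). -/
def IsComp (e e₁ e₂ : Edge C) : Prop :=
  e₁.tgt = e₂.src ∧ e₁.carrier ∩ e₂.carrier = {e₁.tgt} ∧
    e.src = e₁.src ∧ e.tgt = e₂.tgt ∧ e.carrier = e₁.carrier ∪ e₂.carrier

/-- The image of an edge under a diffeomorphism. -/
def map (φ : C.diff) (e : Edge C) : Edge C :=
  ⟨φ.1 '' e.carrier, φ.1 e.src, φ.1 e.tgt, C.image_mem φ.1 φ.2 _ e.mem, e.arc.image φ.1⟩

theorem map_mul (φ ψ : C.diff) (e : Edge C) : e.map (φ * ψ) = (e.map ψ).map φ :=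
  Edge.ext (image_comp φ.1 ψ.1 e.carrier) rfl rfl

theorem map_one (e : Edge C) : e.map (1 : C.diff) = e := Edge.ext (image_id e.carrier) rfl rfl

theorem map_injective (φ : C.diff) : Function.Injective (map φ : Edge C → Edge C) := by
  intro e e' h
  have h1 := congrArg Edge.carrier h
  have h2 := congrArg Edge.src h
  have h3 := congrArg Edge.tgt h
  exact Edge.ext (φ.1.injective.image_injective h1) (φ.1.injective h2) (φ.1.injective h3)

theorem IsComp.map {e e₁ e₂ : Edge C} (h : e.IsComp e₁ e₂) (φ : C.diff) :
    (e.map φ).IsComp (e₁.map φ) (e₂.map φ) := by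
  obtain ⟨h1, h2, h3, h4, h5⟩ := h
  refine ⟨congrArg φ.1 h1, ?_, congrArg φ.1 h3, congrArg φ.1 h4, ?_⟩
  · change φ.1 '' _ ∩ φ.1 '' _ = {φ.1 _}
    rw [← image_inter φ.1.injective, h2, image_singleton]
  · change φ.1 '' _ = φ.1 '' _ ∪ φ.1 '' _
    rw [h5, image_union]

end Edge

/-- A graph embedded in `S`: a finite set of (arbitrarily oriented) edges, any two of which meet
at most in common endpoints. -/
@[ext] structure Graph (C : EdgeCategory S) where
  edges : Finset (Edge C)
  indep : ∀ e ∈ edges, ∀ e' ∈ edges, e ≠ e' →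
    e.carrier ∩ e'.carrier ⊆ {e.src, e.tgt} ∩ {e'.src, e'.tgt}

namespace Graph

/-- `α ≤ γ`: `α` is a subgraph of `γ`. -/
instance : PartialOrder (Graph C) := PartialOrder.lift Graph.edges fun _ _ h => Graph.ext h

theorem finite_subgraphs (γ : Graph C) : {α : Graph C | α ≤ γ}.Finite := by
  refine Set.Finite.of_finite_image (f := Graph.edges)
    ((Finset.finite_toSet γ.edges.powerset).subset ?_) (fun _ _ _ _ h => Graph.ext h)
  rintro _ ⟨α, hα, rfl⟩
  exact Finset.mem_coe.2 (Finset.mem_powerset.2 hα)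

/-- The finite set of all subgraphs of `γ`, including `γ` itself and the empty graph. -/
noncomputable def subgraphs (γ : Graph C) : Finset (Graph C) := γ.finite_subgraphs.toFinset

open Classical in
/-- The vertices of `γ`: the endpoints of its edges. -/
noncomputable def vertices (γ : Graph C) : Finset S :=
  γ.edges.image Edge.src ∪ γ.edges.image Edge.tgt

/-- The subset of `S` covered by the graph. -/
def support (γ : Graph C) : Set S := ⋃ e ∈ γ.edges, e.carrier

/-- The edges of `γ`, without orientation. -/
def arcs (γ : Graph C) : Set (Set S) := Edge.carrier '' (γ.edges : Set (Edge C))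

/-- The graph with a single edge. -/
def single (e : Edge C) : Graph C :=
  ⟨{e}, fun _ ha _ hb h => absurd
    ((Finset.mem_singleton.1 ha).trans (Finset.mem_singleton.1 hb).symm) h⟩

open Classical in
/-- The image of a graph under a diffeomorphism. -/
noncomputable def map (φ : C.diff) (γ : Graph C) : Graph C where
  edges := γ.edges.image (Edge.map φ)
  indep := by
    intro a ha b hb hab
    obtain ⟨e, he, rfl⟩ := Finset.mem_image.1 ha
    obtain ⟨e', he', rfl⟩ := Finset.mem_image.1 hb
    have h := γ.indep e he e' he' (fun h => hab (h ▸ rfl))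
    change φ.1 '' _ ∩ φ.1 '' _ ⊆ {φ.1 _, φ.1 _} ∩ {φ.1 _, φ.1 _}
    rw [← image_inter φ.1.injective, ← image_pair, ← image_pair, ← image_inter φ.1.injective]
    exact image_mono h

/-- `e` is a composition of edges of `γ` and of their inverses. -/
inductive Generates (γ : Graph C) : Edge C → Prop
  | edge (e : Edge C) : e ∈ γ.edges → Generates γ e
  | rev (e : Edge C) : Generates γ e → Generates γ e.rev
  | comp (e e₁ e₂ : Edge C) : e.IsComp e₁ e₂ → Generates γ e₁ → Generates γ e₂ → Generates γ e

end Graph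
theorem exists_cut_points (e e' : Edge C) : ∃ P : Set S, P.Finite ∧
    ∀ x ∈ e.carrier ∩ e'.carrier, x ∈ P ∨ ∃ M u v, ArcFromTo M u v ∧ u ∈ P ∧ v ∈ P ∧ x ∈ M ∧
      M ⊆ e.carrier ∩ e'.carrier := by
  obtain ⟨F, M, hF, hM, hMarc, hinter⟩ := C.inter _ e.mem _ e'.mem
  have : Nonempty S := ⟨e.src⟩
  choose! u v huv using hMarc
  refine ⟨F ∪ (u '' M ∪ v '' M), hF.union ((hM.image u).union (hM.image v)), fun x hx => ?_⟩
  rcases hinter.subset hx with h | ⟨m, hm, hxm⟩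
  · exact Or.inl (Or.inl h)
  · refine Or.inr ⟨m, u m, v m, huv m hm, Or.inr (Or.inl ⟨m, hm, rfl⟩),
      Or.inr (Or.inr ⟨m, hm, rfl⟩), hxm, ?_⟩
    rw [hinter]
    exact fun y hy => Or.inr ⟨m, hm, hy⟩

/-- Finitely many edges can be decomposed into the edges of a common graph. -/
theorem exists_graph [T2Space S] (F : Finset (Edge C)) :
    ∃ γ : Graph C, ∀ e ∈ F, γ.Generates e := by
  classical
  rcases isEmpty_or_nonempty (Edge C) with hE | hE
  · exact ⟨⟨∅, by simp⟩, fun e => hE.elim e⟩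
  choose Q hQfin hQ using fun e e' : Edge C => exists_cut_points e e'
  let P : Set S := (⋃ e ∈ F, ⋃ e' ∈ F, Q e e') ∪ (Edge.src '' (F : Set (Edge C)) ∪
    Edge.tgt '' (F : Set (Edge C)))
  have hPfin : P.Finite :=
    (F.finite_toSet.biUnion fun e _ => F.finite_toSet.biUnion fun e' _ => hQfin e e').union
      ((F.finite_toSet.image _).union (F.finite_toSet.image _))
  have hQP : ∀ e ∈ F, ∀ e' ∈ F, Q e e' ⊆ P := fun e he e' he' x hx =>
    Or.inl (mem_iUnion₂.2 ⟨e, he, mem_iUnion₂.2 ⟨e', he', hx⟩⟩)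
  let X : Set (Edge C) := {k | k.src ∈ P ∧ k.tgt ∈ P ∧ k.carrier ∩ P ⊆ {k.src, k.tgt} ∧
    ∃ e ∈ F, k.carrier ⊆ e.carrier}
  have hXsub : ∀ k ∈ X, ∀ l ∈ X, ∀ x ∈ k.carrier ∩ l.carrier, x ∉ P →
      k.carrier ⊆ l.carrier := by
    rintro k ⟨-, -, hkP, e, he, hke⟩ l ⟨hls, hlt, -, e', he', hle⟩ x hx hxP
    rcases hQ e e' x ⟨hke hx.1, hle hx.2⟩ with h | ⟨M, u, v, hM, hu, hv, hxM, hMe⟩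
    · exact absurd (hQP e he e' he' h) hxP
    · have h1 : k.carrier ⊆ M := ArcFromTo.piece_subset (C.isArc _ e.mem) k.arc hM hke
        (hMe.trans inter_subset_left) hkP (hQP e he e' he' hu) (hQP e he e' he' hv) hx.1 hxM hxP
      exact ArcFromTo.piece_subset (C.isArc _ e'.mem) k.arc l.arc
        (h1.trans (hMe.trans inter_subset_right)) hle hkP hls hlt hx.1 hx.2 hxP
  have hXfin : X.Finite := by
    have : X ⊆ ⋃ e ∈ F, ⋃ u ∈ P, ⋃ v ∈ P,
        {k : Edge C | k.carrier ⊆ e.carrier ∧ k.src = u ∧ k.tgt = v} := by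
      rintro k ⟨h1, h2, -, e, he, h3⟩
      simp only [mem_iUnion]
      exact ⟨e, he, _, h1, _, h2, h3, rfl, rfl⟩
    refine Set.Finite.subset (F.finite_toSet.biUnion fun e _ => hPfin.biUnion fun u _ =>
      hPfin.biUnion fun v _ => Set.Subsingleton.finite ?_) this
    rintro k ⟨hk, rfl, rfl⟩ l ⟨hl, h1, h2⟩
    have harc := l.arc
    rw [h1, h2] at harc
    exact Edge.ext (ArcFromTo.unique (C.isArc _ e.mem) k.arc harc hk hl) h1.symm h2.symm
  have hpick : ∀ K ∈ Edge.carrier '' X, ∃ k ∈ X, k.carrier = K := fun K hK => hK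
  choose! pick hpickX hpickc using hpick
  let γ : Graph C :=
    { edges := ((hXfin.image Edge.carrier).image pick).toFinset
      indep := by
        intro k hk l hl hkl x hx
        rw [Set.Finite.mem_toFinset] at hk hl
        obtain ⟨K, hK, rfl⟩ := hk
        obtain ⟨L, hL, rfl⟩ := hl
        have hkX := hpickX K hK
        have hlX := hpickX L hL
        have hxP : x ∈ P := by
          by_contra hxP
          have h1 := hXsub _ hkX _ hlX x hx hxP
          have h2 := hXsub _ hlX _ hkX x hx.symm hxP
          apply hkl
          have := h1.antisymm h2
          rw [hpickc K hK, hpickc L hL] at this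
          rw [this]
        exact ⟨hkX.2.2.1 ⟨hx.1, hxP⟩, hlX.2.2.1 ⟨hx.2, hxP⟩⟩ }
  have hgenX : ∀ k ∈ X, γ.Generates k := by
    intro k hk
    have hK : k.carrier ∈ Edge.carrier '' X := ⟨k, hk, rfl⟩
    have hg : γ.Generates (pick k.carrier) := .edge _ (by
      rw [Set.Finite.mem_toFinset]; exact ⟨_, hK, rfl⟩)
    have harc := (pick k.carrier).arc
    rw [hpickc _ hK] at harc
    rcases harc.endpoints k.arc with ⟨h1, h2⟩ | ⟨h1, h2⟩
    · have : k = pick k.carrier := Edge.ext (hpickc _ hK).symm h1 h2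
      rw [this]; exact hg
    · have : k = (pick k.carrier).rev := Edge.ext (hpickc _ hK).symm h1 h2
      rw [this]; exact .rev _ hg
  have main : ∀ (n : ℕ) (k : Edge C), (P ∩ k.carrier).ncard = n → k.src ∈ P → k.tgt ∈ P →
      (∃ e ∈ F, k.carrier ⊆ e.carrier) → γ.Generates k := by
    intro n
    induction n using Nat.strong_induction_on with
    | _ n ih =>
      intro k hn hs ht hsub
      by_cases hX : k.carrier ∩ P ⊆ {k.src, k.tgt}
      · exact hgenX k ⟨hs, ht, hX, hsub⟩
      · obtain ⟨z, hz, hzn⟩ := not_subset.1 hX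
        obtain ⟨e, he, hke⟩ := hsub
        obtain ⟨K₁, K₂, a1, a2, hint, hun, hy, hx⟩ := k.arc.cut hz.1
          (fun h => hzn (Or.inl h)) (fun h => hzn (Or.inr h))
        have i1 : K₁ ⊆ k.carrier := hun ▸ subset_union_left
        have i2 : K₂ ⊆ k.carrier := hun ▸ subset_union_right
        let k₁ : Edge C := ⟨K₁, k.src, z, C.subarc _ k.mem _ i1 ⟨_, _, a1⟩, a1⟩
        let k₂ : Edge C := ⟨K₂, z, k.tgt, C.subarc _ k.mem _ i2 ⟨_, _, a2⟩, a2⟩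
        have hlt : ∀ L w, L ⊆ k.carrier → w ∈ P → w ∈ k.carrier → w ∉ L →
            (P ∩ L).ncard < n := fun L w hL hwP hwk hwL => by
          rw [← hn]
          refine ncard_lt_ncard ⟨inter_subset_inter_right _ hL, fun h => hwL ?_⟩
            (hPfin.subset inter_subset_left)
          exact (h ⟨hwP, hwk⟩).2
        refine .comp k k₁ k₂ ⟨rfl, hint, rfl, rfl, hun⟩ ?_ ?_
        · exact ih _ (hlt K₁ _ i1 ht k.arc.symm.left_mem hy) k₁ rfl hs hz.2
            ⟨e, he, i1.trans hke⟩
        · exact ih _ (hlt K₂ _ i2 hs k.arc.left_mem hx) k₂ rfl hz.2 ht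
            ⟨e, he, i2.trans hke⟩
  exact ⟨γ, fun e he => main _ e rfl (Or.inr (Or.inl ⟨e, he, rfl⟩))
    (Or.inr (Or.inr ⟨e, he, rfl⟩)) ⟨e, he, Subset.rfl⟩⟩


/-- Generalized connections: homomorphisms from the groupoid of paths (generated by the edges) to
the structure group `G`, given by their holonomies along edges. It carries the `σ`-algebra
generated by the holonomies. -/
def Conn (C : EdgeCategory S) (G : Type*) [Group G] : Type _ :=
  {A : Edge C → G // (∀ e, A e.rev = (A e)⁻¹) ∧
    ∀ e e₁ e₂ : Edge C, e.IsComp e₁ e₂ → A e = A e₁ * A e₂}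

section Connections

variable {G : Type*} [Group G]

instance [MeasurableSpace G] : MeasurableSpace (Conn C G) := Subtype.instMeasurableSpace

/-- The holonomies of a connection along the edges of a graph. -/
def Graph.eval (γ : Graph C) (A : Conn C G) : γ.edges → G := fun e => A.1 e

/-- Pull-back of connections: `(φ^* A)(e) = A(φ(e))`. -/
def Conn.pullback (φ : C.diff) (A : Conn C G) : Conn C G :=
  ⟨fun e => A.1 (e.map φ), fun e => A.2.1 (e.map φ), fun _ _ _ h => A.2.2 _ _ _ (h.map φ)⟩

variable [MeasurableSpace G]

theorem measurable_hol (e : Edge C) : Measurable fun A : Conn C G => A.1 e :=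
  (measurable_pi_apply e).comp measurable_subtype_coe

theorem measurable_pullback (φ : C.diff) :
    Measurable (Conn.pullback φ : Conn C G → Conn C G) :=
  Measurable.subtype_mk (f := fun (A : Conn C G) (e : Edge C) => A.1 (e.map φ))
    (measurable_pi_lambda _ fun e => measurable_hol (e.map φ))

theorem measurable_eval (γ : Graph C) : Measurable (γ.eval : Conn C G → (γ.edges → G)) :=
  measurable_pi_lambda _ fun e => measurable_hol e.1

variable [TopologicalSpace G] [IsTopologicalGroup G] [CompactSpace G] [BorelSpace G]

/-- The normalized Haar measure of a compact group. -/
noncomputable def haarProb (G : Type*) [Group G] [MeasurableSpace G] [TopologicalSpace G]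
    [IsTopologicalGroup G] [CompactSpace G] [BorelSpace G] : Measure G :=
  Measure.haarMeasure (⊤ : TopologicalSpace.PositiveCompacts G)

instance : IsProbabilityMeasure (haarProb G) :=
  ⟨by simpa [haarProb] using Measure.haarMeasure_self (K₀ := (⊤ : TopologicalSpace.PositiveCompacts G))⟩

/-- `μ` is the Ashtekar-Lewandowski measure: the holonomies along the edges of any graph are
independent and Haar distributed. This determines `μ` uniquely, see `IsAshtekarLewandowski.unique`. -/
class IsAshtekarLewandowski (μ : Measure (Conn C G)) : Prop where
  eval : ∀ γ : Graph C, MeasurePreserving γ.eval μ (Measure.pi fun _ => haarProb G)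

variable [SecondCountableTopology G] {μ ν : Measure (Conn C G)}

theorem IsAshtekarLewandowski.isProbabilityMeasure [h : IsAshtekarLewandowski μ] :
    IsProbabilityMeasure μ := by
  have h0 := h.eval ⟨∅, by simp⟩
  exact ⟨by rw [← preimage_univ, h0.measure_preimage MeasurableSet.univ.nullMeasurableSet,
    measure_univ]⟩

theorem Graph.Generates.word {γ : Graph C} {e : Edge C} (h : γ.Generates e) :
    ∃ w : (γ.edges → G) → G, Measurable w ∧ ∀ A : Conn C G, A.1 e = w (γ.eval A) := by
  induction h with
  | edge e he => exact ⟨fun a => a ⟨e, he⟩, measurable_pi_apply _, fun A => rfl⟩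
  | rev e _ ih =>
    obtain ⟨w, hw, h⟩ := ih
    exact ⟨fun a => (w a)⁻¹, hw.inv, fun A => by rw [A.2.1, h]⟩
  | comp e e₁ e₂ hc _ _ ih₁ ih₂ =>
    obtain ⟨w₁, hw₁, h₁⟩ := ih₁
    obtain ⟨w₂, hw₂, h₂⟩ := ih₂
    exact ⟨fun a => w₁ a * w₂ a, hw₁.mul hw₂, fun A => by rw [A.2.2 _ _ _ hc, h₁, h₂]⟩

/-- Uniqueness of the Ashtekar-Lewandowski measure. -/
theorem IsAshtekarLewandowski.unique [T2Space S] [hμ : IsAshtekarLewandowski μ]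
    [hν : IsAshtekarLewandowski ν] : μ = ν := by
  classical
  have := hμ.isProbabilityMeasure
  have := hν.isProbabilityMeasure
  let Cyl : Set (Set (Conn C G)) :=
    {s | ∃ (γ : Graph C) (B : Set (γ.edges → G)), MeasurableSet B ∧ s = γ.eval ⁻¹' B}
  have hmeas : ∀ s ∈ Cyl, MeasurableSet s := by
    rintro _ ⟨γ, B, hB, rfl⟩
    exact measurable_eval γ hB
  refine ext_of_generate_finite Cyl ?_ ?_ ?_ (by simp)
  · refine le_antisymm ?_ (MeasurableSpace.generateFrom_le hmeas)
    have h1 : Measurable[MeasurableSpace.generateFrom Cyl] fun A : Conn C G => A.1 := by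
      refine @measurable_pi_lambda _ _ _ (MeasurableSpace.generateFrom Cyl) _ _ fun e => ?_
      intro B hB
      refine MeasurableSpace.measurableSet_generateFrom ⟨Graph.single e,
        (fun a => a ⟨e, Finset.mem_singleton_self e⟩) ⁻¹' B, measurable_pi_apply _ hB, rfl⟩
    exact h1.comap_le
  · rintro _ ⟨γ₁, B₁, hB₁, rfl⟩ _ ⟨γ₂, B₂, hB₂, rfl⟩ -
    obtain ⟨γ, hγ⟩ := exists_graph (γ₁.edges ∪ γ₂.edges)
    have h1 : ∀ e : γ₁.edges, ∃ w : (γ.edges → G) → G, Measurable w ∧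
        ∀ A : Conn C G, A.1 e = w (γ.eval A) :=
      fun e => (hγ e (Finset.mem_union_left _ e.2)).word
    have h2 : ∀ e : γ₂.edges, ∃ w : (γ.edges → G) → G, Measurable w ∧
        ∀ A : Conn C G, A.1 e = w (γ.eval A) :=
      fun e => (hγ e (Finset.mem_union_right _ e.2)).word
    choose w₁ hw₁ e₁ using h1
    choose w₂ hw₂ e₂ using h2
    refine ⟨γ, (fun a e => w₁ e a) ⁻¹' B₁ ∩ (fun a e => w₂ e a) ⁻¹' B₂,
      (measurable_pi_lambda _ hw₁ hB₁).inter (measurable_pi_lambda _ hw₂ hB₂), ?_⟩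
    have h1 : (γ₁.eval : Conn C G → _) = (fun a e => w₁ e a) ∘ γ.eval := by
      funext A e; exact e₁ e A
    have h2 : (γ₂.eval : Conn C G → _) = (fun a e => w₂ e a) ∘ γ.eval := by
      funext A e; exact e₂ e A
    rw [h1, h2]; rfl
  · rintro _ ⟨γ, B, hB, rfl⟩
    rw [(hμ.eval γ).measure_preimage hB.nullMeasurableSet,
      (hν.eval γ).measure_preimage hB.nullMeasurableSet]

/-- Diffeomorphism invariance of the Ashtekar-Lewandowski measure. -/
theorem measurePreserving_pullback [T2Space S] (μ : Measure (Conn C G))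
    [hμ : IsAshtekarLewandowski μ] (φ : C.diff) :
    MeasurePreserving (Conn.pullback φ) μ μ := by
  classical
  refine ⟨measurable_pullback φ, ?_⟩
  have : IsAshtekarLewandowski (μ.map (Conn.pullback φ)) := by
    refine ⟨fun γ => ⟨measurable_eval γ, ?_⟩⟩
    rw [Measure.map_map (measurable_eval γ) (measurable_pullback φ)]
    have hm : ∀ e : γ.edges, e.1.map φ ∈ (γ.map φ).edges := fun e =>
      Finset.mem_image_of_mem _ e.2
    let r : γ.edges ≃ (γ.map φ).edges := Equiv.ofBijective (fun e => ⟨e.1.map φ, hm e⟩) (by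
      constructor
      · intro e e' h
        exact Subtype.ext (Edge.map_injective φ (congrArg Subtype.val h))
      · rintro ⟨e, he⟩
        obtain ⟨k, hk, rfl⟩ := Finset.mem_image.1 he
        exact ⟨⟨k, hk⟩, rfl⟩)
    have h1 := measurePreserving_piCongrLeft (fun _ : γ.edges => haarProb G) r.symm
    have h2 := h1.comp (hμ.eval (γ.map φ))
    convert h2.map_eq using 2
    funext A e
    have := MeasurableEquiv.piCongrLeft_apply_apply (β := fun _ : γ.edges => G) r.symm
      ((γ.map φ).eval A) (r e)
    simp only [Equiv.symm_apply_apply] at this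
    exact this.symm
  exact IsAshtekarLewandowski.unique

end Connections

/-! ### Symmetries of graphs -/

namespace Graph

/-- `Diff_γ`: the diffeomorphisms mapping the graph `γ` to itself (every edge onto an edge,
possibly reversing its orientation). -/
def Diff (γ : Graph C) : Subgroup C.diff where
  carrier := {φ | (fun K => φ.1 '' K) '' γ.arcs = γ.arcs}
  one_mem' := by
    change (fun K => id '' K) '' γ.arcs = γ.arcs
    simp
  mul_mem' := by
    intro φ ψ hφ hψ
    change (fun K => (φ.1 ∘ ψ.1) '' K) '' γ.arcs = γ.arcs
    conv_rhs => rw [← hφ, ← hψ]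
    simp only [image_image, Function.comp_apply]
  inv_mem' := by
    intro φ hφ
    change (fun K => (φ.1.symm : S → S) '' K) '' γ.arcs = γ.arcs
    conv_lhs => rw [← hφ]
    simp [image_image]

/-- `TDiff_γ`: the elements of `Diff_γ` that map every edge of `γ` to itself, with its
orientation. -/
def TDiff (γ : Graph C) : Subgroup γ.Diff where
  carrier := {φ | ∀ e ∈ γ.edges, e.map φ.1 = e}
  one_mem' := fun e _ => e.map_one
  mul_mem' := by
    intro φ ψ hφ hψ e he
    rw [Subgroup.coe_mul, Edge.map_mul, hψ e he, hφ e he]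
  inv_mem' := by
    intro φ hφ e he
    have : (e.map φ.1).map (φ.1)⁻¹ = e := by
      rw [← Edge.map_mul, inv_mul_cancel, Edge.map_one]
    rwa [hφ e he] at this

theorem map_eq_or [T2Space S] {γ : Graph C} {φ : C.diff} (hφ : φ ∈ γ.Diff) {e : Edge C}
    (he : e ∈ γ.edges) : ∃ k ∈ γ.edges, e.map φ = k ∨ e.map φ = k.rev := by
  have h1 : φ.1 '' e.carrier ∈ γ.arcs := by
    have : (fun K => φ.1 '' K) '' γ.arcs = γ.arcs := hφ
    rw [← this]
    exact ⟨_, ⟨e, he, rfl⟩, rfl⟩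
  obtain ⟨k, hk, hkc⟩ := h1
  refine ⟨k, hk, ?_⟩
  have harc := k.arc
  rw [hkc] at harc
  rcases harc.endpoints (e.map φ).arc with ⟨h1, h2⟩ | ⟨h1, h2⟩
  · exact Or.inl (Edge.ext hkc.symm h1 h2)
  · exact Or.inr (Edge.ext hkc.symm h1 h2)

instance [T2Space S] (γ : Graph C) : γ.TDiff.Normal where
  conj_mem := by
    intro t ht φ e he
    have h2 : (e.map (φ.1)⁻¹).map t.1 = e.map (φ.1)⁻¹ := by
      obtain ⟨k, hk, h | h⟩ := map_eq_or (γ.Diff.inv_mem φ.2) he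
      · rw [h, ht k hk]
      · rw [h]
        exact congrArg Edge.rev (ht k hk)
    rw [Subgroup.coe_mul, Subgroup.coe_mul, Subgroup.coe_inv, Edge.map_mul, Edge.map_mul, h2,
      ← Edge.map_mul, mul_inv_cancel, Edge.map_one]

/-- The group `GS_γ = Diff_γ / TDiff_γ` of graph symmetries of `γ`. -/
abbrev GS (γ : Graph C) : Type _ := γ.Diff ⧸ γ.TDiff

/-- Graph symmetry groups are finite. -/
instance [T2Space S] (γ : Graph C) : Finite γ.GS := by
  classical
  let E : Finset (Edge C) := γ.edges ∪ γ.edges.image Edge.rev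
  have hE : ∀ (φ : γ.Diff) (e : γ.edges), e.1.map φ.1 ∈ E := fun φ e => by
    obtain ⟨k, hk, h | h⟩ := map_eq_or φ.2 e.2
    · rw [h]; exact Finset.mem_union_left _ hk
    · rw [h]; exact Finset.mem_union_right _ (Finset.mem_image_of_mem _ hk)
  refine Finite.of_injective
    (fun (q : γ.GS) (e : γ.edges) => (⟨e.1.map q.out.1, hE _ e⟩ : E)) fun q q' h => ?_
  rw [← q.out_eq, ← q'.out_eq]
  refine QuotientGroup.eq.2 fun e he => ?_
  have h1 : e.map q.out.1 = e.map q'.out.1 := congrArg Subtype.val (congrFun h ⟨e, he⟩)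
  rw [Subgroup.coe_mul, Subgroup.coe_inv, Edge.map_mul, ← h1, ← Edge.map_mul, inv_mul_cancel,
    Edge.map_one]

/-- The natural map from the graph symmetries of `γ₀` (preserving `α`) to those of `α` is onto, for
every subgraph `α`: every symmetry of `α` is represented by a diffeomorphism that represents a
symmetry of `γ₀`. -/
def SymmetriesExtend (γ₀ : Graph C) : Prop :=
  ∀ α ≤ γ₀, ∀ q : α.GS, ∃ g : C.diff, g ∈ γ₀.Diff ∧ ∃ h : g ∈ α.Diff,
    (QuotientGroup.mk ⟨g, h⟩ : α.GS) = q

/-- The classes `[φ] ∈ Diff / Diff_α` that embed `α` into `γ₀`, i.e. map `α` onto a subgraph of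
`γ₀`. Subgraphs are compared as point sets: gauge invariant states do not detect where a curve is
subdivided by bivalent vertices. -/
def embeddings (α γ₀ : Graph C) : Set (C.diff ⧸ α.Diff) :=
  {q | ∃ φ : C.diff, (φ : C.diff ⧸ α.Diff) = q ∧ ∃ β ≤ γ₀, φ.1 '' α.support = β.support}

/-- Every re-embedding of a subgraph into `γ₀` has a representative in a graph symmetry
of `γ₀`. -/
def EmbeddingsAreSymmetries (γ₀ : Graph C) : Prop :=
  ∀ α ≤ γ₀, ∀ q ∈ embeddings α γ₀, ∃ g ∈ γ₀.Diff, (g : C.diff ⧸ α.Diff) = q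

/-- The number `n(α, γ₀)` of different embeddings of `α` into `γ₀`. -/
noncomputable def numEmbeddings (α γ₀ : Graph C) : ℕ := (embeddings α γ₀).ncard

end Graph

/-! ### The kinematical Hilbert space -/

section Hilbert

variable {G : Type*} [Group G] [MeasurableSpace G] [TopologicalSpace G] [IsTopologicalGroup G]
  [CompactSpace G] [BorelSpace G]

/-- Functions of the holonomies along the edges of `γ` that are invariant under the gauge
transformations `A(e) ↦ g(s(e))⁻¹ A(e) g(t(e))`. -/
def Graph.GaugeInvariant (γ : Graph C) (F : (γ.edges → G) → ℂ) : Prop :=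
  ∀ (g : S → G) (a : γ.edges → G), F (fun e => (g e.1.src)⁻¹ * a e * g e.1.tgt) = F a

section Spaces

variable (μ : Measure (Conn C G))

/-- `Cyl_γ`: gauge invariant continuous functions of the holonomies along the edges of `γ`, as
elements of `L²(μ)`. -/
def Cyl (γ : Graph C) : Submodule ℂ (Lp ℂ 2 μ) where
  carrier := {f | ∃ F : C(γ.edges → G, ℂ), γ.GaugeInvariant F ∧ f =ᵐ[μ] fun A => F (γ.eval A)}
  zero_mem' := ⟨0, fun _ _ => rfl, Lp.coeFn_zero ℂ 2 μ⟩
  add_mem' := by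
    rintro f f' ⟨F, hF, hf⟩ ⟨F', hF', hf'⟩
    refine ⟨F + F', fun g a => congrArg₂ (· + ·) (hF g a) (hF' g a), ?_⟩
    filter_upwards [Lp.coeFn_add f f', hf, hf'] with A h h1 h2
    rw [h, Pi.add_apply, h1, h2]; rfl
  smul_mem' := by
    rintro c f ⟨F, hF, hf⟩
    refine ⟨c • F, fun g a => congrArg (c • ·) (hF g a), ?_⟩
    filter_upwards [Lp.coeFn_smul c f, hf] with A h h1
    rw [h, Pi.smul_apply, h1]; rfl

/-- `H_γ`, the closure of `Cyl_γ`. -/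
noncomputable def Hgr (γ : Graph C) : Submodule ℂ (Lp ℂ 2 μ) := (Cyl μ γ).topologicalClosure

/-- `H'_γ`: the orthogonal complement in `H_γ` of the spaces of all proper subgraphs. -/
noncomputable def Hgr' (γ : Graph C) : Submodule ℂ (Lp ℂ 2 μ) :=
  Hgr μ γ ⊓ (⨆ (β : Graph C) (_ : β < γ), Hgr μ β)ᗮ

instance (γ : Graph C) : CompleteSpace (Hgr μ γ) :=
  (Cyl μ γ).isClosed_topologicalClosure.completeSpace_coe

instance (γ : Graph C) : CompleteSpace (Hgr' μ γ) := by
  have h : IsClosed (Hgr' μ γ : Set (Lp ℂ 2 μ)) := (Cyl μ γ).isClosed_topologicalClosure.inter (Submodule.isClosed_orthogonal _)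
  exact h.completeSpace_coe

/-- `P'_γ`, the orthogonal projector onto `H'_γ`. -/
noncomputable def proj' (γ : Graph C) : Lp ℂ 2 μ →L[ℂ] Lp ℂ 2 μ := (Hgr' μ γ).starProjection

/-- The states based on finitely many graphs. Diffeomorphism invariant states are linear
functionals on this space. -/
noncomputable def CylSpace : Submodule ℂ (Lp ℂ 2 μ) := ⨆ γ : Graph C, Hgr μ γ

end Spaces

variable [SecondCountableTopology G] [T2Space S]

section Diffeomorphisms

variable (μ : Measure (Conn C G)) [IsAshtekarLewandowski μ]

/-- The action of diffeomorphisms on states, `(U_φ f)(A) = f(φ^* A)`. -/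
noncomputable def U (φ : C.diff) : Lp ℂ 2 μ →ₗᵢ[ℂ] Lp ℂ 2 μ :=
  Lp.compMeasurePreservingₗᵢ ℂ (Conn.pullback φ) (measurePreserving_pullback μ φ)

/-- `H_diff`: the diffeomorphism invariant linear functionals. -/
def Hdiff : Submodule ℂ (Module.Dual ℂ (CylSpace μ)) where
  carrier := {L | ∀ (φ : C.diff) (f f' : CylSpace μ), (f' : Lp ℂ 2 μ) = U μ φ f → L f' = L f}
  zero_mem' := fun _ _ _ _ => rfl
  add_mem' := fun h h' φ f f' e => congrArg₂ (· + ·) (h φ f f' e) (h' φ f f' e)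
  smul_mem' := fun c _ h φ f f' e => congrArg (c • ·) (h φ f f' e)

/-- Averaging over the group of graph symmetries of `γ` (on `H_γ` the summands do not depend on
the chosen representatives). -/
noncomputable def symAverage (γ : Graph C) (Ψ : Lp ℂ 2 μ) : Lp ℂ 2 μ :=
  (Nat.card γ.GS : ℂ)⁻¹ • ∑ᶠ g : γ.GS, U μ (g.out : γ.Diff) Ψ

/-- `L = η(Ψ)` for `Ψ ∈ H'_γ`, where `η` is the rigging map
`(η(Ψ)| f⟩ = ∑_{[φ] ∈ Diff / Diff_γ} (1/|GS_γ|) ∑_{g ∈ GS_γ} ⟨U_φ U_g Ψ | f⟩`. -/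
def IsRigged (γ : Graph C) (Ψ : Lp ℂ 2 μ) (L : Module.Dual ℂ (CylSpace μ)) : Prop :=
  ∀ f : CylSpace μ, HasSum
    (fun q : C.diff ⧸ γ.Diff => inner ℂ (U μ q.out (symAverage μ γ Ψ)) (f : Lp ℂ 2 μ)) (L f)

end Diffeomorphisms

/-! ### Hamilton constraints -/

/-- The Kronecker delta function at the point `v`. -/
noncomputable def delta (v : S) : S → ℝ := Set.indicator {v} 1

/-- For an unbounded operator `T`, the operator `T T†` with its natural domain. -/
noncomputable def mulAdjoint {E : Type*} [NormedAddCommGroup E] [InnerProductSpace ℂ E]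
    [CompleteSpace E] (T : E →ₗ.[ℂ] E) : E →ₗ.[ℂ] E where
  domain :=
    { carrier := {x | ∃ h : x ∈ T.adjoint.domain, T.adjoint ⟨x, h⟩ ∈ T.domain}
      zero_mem' := ⟨zero_mem _, (T.adjoint.map_zero).symm ▸ zero_mem _⟩
      add_mem' := fun ⟨hx, h⟩ ⟨hy, h'⟩ =>
        ⟨add_mem hx hy, (T.adjoint.map_add ⟨_, hx⟩ ⟨_, hy⟩).symm ▸ add_mem h h'⟩
      smul_mem' := fun c _ ⟨hx, h⟩ =>
        ⟨Submodule.smul_mem _ c hx,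
          (T.adjoint.map_smul c ⟨_, hx⟩).symm ▸ Submodule.smul_mem _ c h⟩ }
  toFun := T.toFun ∘ₗ
    { toFun := fun x => ⟨T.adjoint ⟨x.1, x.2.choose⟩, x.2.choose_spec⟩
      map_add' := fun x y => Subtype.ext (T.adjoint.map_add ⟨x.1, x.2.choose⟩ ⟨y.1, y.2.choose⟩)
      map_smul' := fun c x => Subtype.ext (T.adjoint.map_smul c ⟨x.1, x.2.choose⟩) }

variable (μ : Measure (Conn C G))

/-- A family `N ↦ H(N)` of graph preserving Hamilton constraint operators on a common domain that
is dense in every `H_γ`. On `H_γ`, the operator `H(N)` is the sum of the vertex operators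
`H_v = H(δ_v)`, `v ∈ V(γ)`, weighted with the lapse `N(v)`. -/
structure HamiltonConstraints where
  dom : Submodule ℂ (Lp ℂ 2 μ)
  dense : ∀ γ : Graph C, Hgr μ γ ≤ (dom ⊓ Hgr μ γ).topologicalClosure
  op : (S → ℝ) → dom →ₗ[ℂ] Lp ℂ 2 μ
  graph_preserving : ∀ (N : S → ℝ) (γ : Graph C) (f : dom), (f : Lp ℂ 2 μ) ∈ Hgr μ γ →
    op N f ∈ Hgr μ γ
  vertex_sum : ∀ (N : S → ℝ) (γ : Graph C) (f : dom), (f : Lp ℂ 2 μ) ∈ Hgr μ γ →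
    op N f = ∑ v ∈ γ.vertices, (N v : ℂ) • op (delta v) f

namespace HamiltonConstraints

variable {μ} (H : HamiltonConstraints μ)

theorem mem_cylSpace (N : S → ℝ) {γ : Graph C} {f : H.dom} (hf : (f : Lp ℂ 2 μ) ∈ Hgr μ γ) :
    H.op N f ∈ CylSpace μ :=
  le_iSup (fun γ : Graph C => Hgr μ γ) γ (H.graph_preserving N γ f hf)

/-- The restriction of the vertex operator `H_v` to `H_γ`. -/
noncomputable def restrict (γ : Graph C) (v : S) : Hgr μ γ →ₗ.[ℂ] Hgr μ γ where
  domain := H.dom.comap (Hgr μ γ).subtype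
  toFun := LinearMap.codRestrict (Hgr μ γ)
    (H.op (delta v) ∘ₗ (Hgr μ γ).subtype.restrict (fun _ hx => hx)) fun f =>
      H.graph_preserving _ γ ⟨f.1.1, f.2⟩ f.1.2

/-- The quadratic operator `Q = ∑_v H_v H_v†` on `H_γ`. -/
noncomputable def quadratic (γ : Graph C) : Hgr μ γ →ₗ.[ℂ] Hgr μ γ :=
  ∑ v ∈ γ.vertices, mulAdjoint (H.restrict γ v)

/-- `H` is covariant under the graph symmetries of `γ`:
`U_φ H_v U_φ⁻¹ = H_{φ(v)}` on `H_γ`, for every `φ` representing a graph symmetry of `γ`. -/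
def IsCovariant [IsAshtekarLewandowski μ] (γ : Graph C) : Prop :=
  ∀ φ ∈ γ.Diff, ∀ v ∈ γ.vertices, ∀ f : H.dom, (f : Lp ℂ 2 μ) ∈ Hgr μ γ →
    ∃ h : U μ φ f ∈ H.dom, H.op (delta (φ.1 v)) ⟨U μ φ f, h⟩ = U μ φ (H.op (delta v) f)

end HamiltonConstraints

end Hilbert

end LQG

/-!
The argument rests on one orthogonality relation: `H'_α` is orthogonal to `H_β` unless `β` covers
`α` as a point set (`inner_eq_zero_of_not_support_subset`). If an edge `e` of `α` is not contained
in the support of `β`, then a common refinement of both graphs has an edge `k` inside `e` that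
enters neither `β` nor the other edges of `α`. The holonomy along `e` is a word in which that of `k`
occurs exactly once (`Graph.Generates.exists_word`), so by invariance of the Haar measure under
translations and inversion, integrating over it replaces a function of the holonomies along `α` by
its average over the holonomy along `e` (`integral_averageHol`). That average is a state of
`H_{α \ e}`, to which `H'_α` is orthogonal. Two consequences are that `H_γ` is the orthogonal sum of
the `H'_β` with `β ≤ γ` (`sum_proj'_eq`), and that for `Ψ ∈ H'_α` and `f ∈ H_γ` the product
`⟨U_φ Ψ, f⟩` vanishes unless `φ` maps `α` onto a subgraph of `γ`
(`exists_subgraph_of_inner_ne_zero`).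

For `α ≤ γ₀`, the embeddings of `α` into `γ₀` are finitely many, being represented by the finite
group `GS_γ₀`; in particular the stabilizer of the set `|α|` is finite modulo `Diff_α`. Hence the
rigging sum has only finitely many nonzero terms on every cylindrical state, and it defines a
diffeomorphism invariant functional (`exists_isRigged`).

On `H_γ₀` the sum runs over the embeddings of `α` into `γ₀`, on which `GS_γ₀` acts transitively.
Together with the extension of symmetries of `α` to `γ₀` this identifies `n(α, γ₀)⁻¹ η(P'_α Ψ)` with
the average of `P'_α Ψ` over `GS_γ₀` (`IsRigged.apply_eq`), so that the sum over `α` is the average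
of `Ψ` itself. The condition `⟨Ψ, Q Ψ⟩ = ∑ ‖H_v† Ψ‖² = 0` makes `Ψ` orthogonal to the range of every
`H_v` on `H_γ₀` (`HamiltonConstraints.inner_op_eq_zero`), and covariance carries this over to the
average.
-/

set_option linter.unusedSectionVars false

namespace LQG

/-! ### Arcs and subgraphs -/

section Combinatorics

variable {S : Type*} [TopologicalSpace S] {C : EdgeCategory S}

theorem ArcFromTo.infinite {K : Set S} {x y : S} (h : ArcFromTo K x y) : K.Infinite := by
  obtain ⟨f, a, b, hab, -, hi, rfl, -, -⟩ := h
  exact (Icc_infinite hab).image hi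

/-- A set that meets an arc `K` in finitely many points does not contain `K`. -/
theorem Edge.not_subset_of_inter_finite (k : Edge C) {s : Set S} (h : (k.carrier ∩ s).Finite) :
    ¬ k.carrier ⊆ s := fun hk =>
  k.arc.infinite (by rwa [inter_eq_self_of_subset_left hk] at h)

namespace Graph

theorem carrier_subset_support {γ : Graph C} {e : Edge C} (he : e ∈ γ.edges) :
    e.carrier ⊆ γ.support := subset_biUnion_of_mem (u := Edge.carrier) he

theorem inter_finite {γ : Graph C} {e e' : Edge C} (he : e ∈ γ.edges) (he' : e' ∈ γ.edges)
    (h : e ≠ e') : (e.carrier ∩ e'.carrier).Finite :=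
  (toFinite {e.src, e.tgt}).subset ((γ.indep e he e' he' h).trans inter_subset_left)

theorem mem_of_carrier_subset_support {γ δ : Graph C} (hδ : δ ≤ γ) {e : Edge C}
    (he : e ∈ γ.edges) (h : e.carrier ⊆ δ.support) : e ∈ δ.edges := by
  by_contra hne
  refine e.not_subset_of_inter_finite ?_ h
  rw [Graph.support, inter_iUnion₂]
  exact δ.edges.finite_toSet.biUnion fun k hk =>
    inter_finite he (hδ hk) fun h => hne (h ▸ hk)

theorem le_of_support_subset {γ β δ : Graph C} (hβ : β ≤ γ) (hδ : δ ≤ γ)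
    (h : β.support ⊆ δ.support) : β ≤ δ := fun _ he =>
  mem_of_carrier_subset_support hδ (hβ he) ((carrier_subset_support he).trans h)

theorem support_eq_sUnion_arcs (γ : Graph C) : γ.support = ⋃₀ γ.arcs := by
  simp [Graph.support, Graph.arcs, sUnion_image]

theorem arcs_mono {α γ : Graph C} (h : α ≤ γ) : α.arcs ⊆ γ.arcs := image_mono h

theorem mem_subgraphs {α γ : Graph C} : α ∈ γ.subgraphs ↔ α ≤ γ := by
  simp [Graph.subgraphs]

/-- The relation "proper subgraph" is well-founded. -/
protected theorem wellFounded_lt : WellFounded ((· < ·) : Graph C → Graph C → Prop) :=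
  InvImage.wf Graph.edges (IsWellFounded.wf (r := ((· < ·) : Finset (Edge C) → _ → Prop)))

open Classical in
/-- The graph `α` with the edge `e` removed. -/
noncomputable def erase (α : Graph C) (e : Edge C) : Graph C where
  edges := α.edges.erase e
  indep := fun a ha b hb => α.indep a (Finset.mem_of_mem_erase ha) b (Finset.mem_of_mem_erase hb)

theorem mem_erase {α : Graph C} {e k : Edge C} : k ∈ (α.erase e).edges ↔ k ≠ e ∧ k ∈ α.edges := by
  classical
  exact Finset.mem_erase

theorem erase_le (α : Graph C) (e : Edge C) : α.erase e ≤ α := fun _ h => (mem_erase.1 h).2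

theorem erase_lt {α : Graph C} {e : Edge C} (he : e ∈ α.edges) : α.erase e < α :=
  lt_of_le_not_ge (erase_le α e) fun h => (mem_erase.1 (h he)).1 rfl

theorem not_carrier_subset_support_erase {α : Graph C} {e : Edge C} (he : e ∈ α.edges) :
    ¬ e.carrier ⊆ (α.erase e).support := fun h =>
  (mem_erase.1 (mem_of_carrier_subset_support (erase_le α e) he h)).1 rfl

open Classical in
/-- The subgraph of `γ` with a given set of edges. -/
noncomputable def filter (γ : Graph C) (p : Edge C → Prop) : Graph C where
  edges := γ.edges.filter p
  indep := fun a ha b hb =>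
    γ.indep a (Finset.mem_of_mem_filter a ha) b (Finset.mem_of_mem_filter b hb)

theorem mem_filter {γ : Graph C} {p : Edge C → Prop} {e : Edge C} :
    e ∈ (γ.filter p).edges ↔ e ∈ γ.edges ∧ p e := by
  classical
  exact Finset.mem_filter

theorem map_arcs (φ : C.diff) (γ : Graph C) :
    (γ.map φ).arcs = (fun K => φ.1 '' K) '' γ.arcs := by
  classical
  ext K
  simp [Graph.arcs, Graph.map, Edge.map]

theorem map_support (φ : C.diff) (γ : Graph C) : (γ.map φ).support = φ.1 '' γ.support := by
  rw [support_eq_sUnion_arcs, support_eq_sUnion_arcs, map_arcs, image_sUnion]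

theorem image_arcs {γ : Graph C} {φ : C.diff} (h : φ ∈ γ.Diff) :
    (fun K => φ.1 '' K) '' γ.arcs = γ.arcs := h

/-- A graph symmetry of `γ` maps every subgraph onto a subgraph. -/
theorem exists_image_subgraph {α γ : Graph C} (hα : α ≤ γ) {φ : C.diff} (h : φ ∈ γ.Diff) :
    ∃ β ≤ γ, φ.1 '' α.support = β.support := by
  refine ⟨γ.filter fun e => e.carrier ∈ (fun K => φ.1 '' K) '' α.arcs,
    fun e he => (mem_filter.1 he).1, ?_⟩
  rw [support_eq_sUnion_arcs, support_eq_sUnion_arcs, image_sUnion]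
  congr 1
  ext K
  constructor
  · intro hK
    have hK' : K ∈ γ.arcs := by
      rw [← image_arcs h]; exact image_mono (arcs_mono hα) hK
    obtain ⟨e, he, rfl⟩ := hK'
    exact ⟨e, mem_filter.2 ⟨he, hK⟩, rfl⟩
  · rintro ⟨e, he, rfl⟩
    exact (mem_filter.1 he).2

theorem apply_mem_vertices [T2Space S] {γ : Graph C} {φ : C.diff} (h : φ ∈ γ.Diff) {v : S}
    (hv : v ∈ γ.vertices) : φ.1 v ∈ γ.vertices := by
  classical
  have key : ∀ e ∈ γ.edges, φ.1 e.src ∈ γ.vertices ∧ φ.1 e.tgt ∈ γ.vertices := by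
    intro e he
    have hs : ∀ k ∈ γ.edges, k.src ∈ γ.vertices := fun k hk =>
      Finset.mem_union_left _ (Finset.mem_image_of_mem _ hk)
    have ht : ∀ k ∈ γ.edges, k.tgt ∈ γ.vertices := fun k hk =>
      Finset.mem_union_right _ (Finset.mem_image_of_mem _ hk)
    obtain ⟨k, hk, h | h⟩ := map_eq_or h he
    · have h1 : φ.1 e.src = k.src := congrArg Edge.src h
      have h2 : φ.1 e.tgt = k.tgt := congrArg Edge.tgt h
      rw [h1, h2]; exact ⟨hs k hk, ht k hk⟩
    · have h1 : φ.1 e.src = k.tgt := congrArg Edge.src h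
      have h2 : φ.1 e.tgt = k.src := congrArg Edge.tgt h
      rw [h1, h2]; exact ⟨ht k hk, hs k hk⟩
  rcases Finset.mem_union.1 hv with hv | hv
  · obtain ⟨e, he, rfl⟩ := Finset.mem_image.1 hv
    exact (key e he).1
  · obtain ⟨e, he, rfl⟩ := Finset.mem_image.1 hv
    exact (key e he).2

/-- A diffeomorphism preserving every oriented edge of `γ` is a symmetry of every subgraph. -/
theorem mem_diff_of_fixes {α γ : Graph C} (hα : α ≤ γ) {t : γ.Diff} (ht : t ∈ γ.TDiff) :
    (t : C.diff) ∈ α.Diff := by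
  change (fun K => t.1.1 '' K) '' α.arcs = α.arcs
  have : ∀ K ∈ α.arcs, t.1.1 '' K = K := by
    rintro _ ⟨e, he, rfl⟩
    exact congrArg Edge.carrier (ht e (hα he))
  rw [image_congr this, image_id']

theorem out_inv_mul_mem_tDiff [T2Space S] {γ : Graph C} (g : γ.Diff) :
    ((g : γ.GS).out)⁻¹ * g ∈ γ.TDiff :=
  QuotientGroup.eq.1 (Quotient.out_eq' (g : γ.GS))

/-- Every holonomy along an edge generated by `γ` is a word in the holonomies of the edges of `γ`
that cover it, and each of these occurs in the word exactly once, up to inversion. The last two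
clauses express this by replacing the holonomy of a single edge `k` by an arbitrary element. -/
theorem Generates.exists_word [DecidableEq (Edge C)] {G : Type*} [Group G] [MeasurableSpace G]
    [MeasurableMul₂ G] [MeasurableInv G] {γ : Graph C} {e : Edge C} (h : γ.Generates e) :
    ∃ (s : Set γ.edges) (w : (γ.edges → G) → G), e.carrier = ⋃ k ∈ s, k.1.carrier ∧
      Measurable w ∧ (∀ A : Conn C G, A.1 e = w (γ.eval A)) ∧
      (∀ k ∉ s, ∀ a x, w (Function.update a k x) = w a) ∧
      ∀ k ∈ s, ∀ a, ∃ u v, (∀ x, w (Function.update a k x) = u * x * v) ∨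
        ∀ x, w (Function.update a k x) = u * x⁻¹ * v := by
  induction h with
  | edge e he =>
    refine ⟨{⟨e, he⟩}, fun a => a ⟨e, he⟩, by simp, measurable_pi_apply _, fun A => rfl, ?_, ?_⟩
    · intro k hk a x
      exact Function.update_of_ne (fun h => hk h.symm) _ _
    · rintro k rfl a
      exact ⟨1, 1, Or.inl fun x => by simp⟩
  | rev e _ ih =>
    obtain ⟨s, w, hs, hw, hA, h1, h2⟩ := ih
    refine ⟨s, fun a => (w a)⁻¹, hs, hw.inv, fun A => by rw [A.2.1, hA],
      fun k hk a x => by beta_reduce; rw [h1 k hk], fun k hk a => ?_⟩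
    obtain ⟨u, v, h | h⟩ := h2 k hk a
    · exact ⟨v⁻¹, u⁻¹, Or.inr fun x => by beta_reduce; rw [h]; group⟩
    · exact ⟨v⁻¹, u⁻¹, Or.inl fun x => by beta_reduce; rw [h]; group⟩
  | comp e e₁ e₂ hc _ _ ih₁ ih₂ =>
    obtain ⟨s₁, w₁, hs₁, hw₁, hA₁, h1₁, h2₁⟩ := ih₁
    obtain ⟨s₂, w₂, hs₂, hw₂, hA₂, h1₂, h2₂⟩ := ih₂
    -- The two factors share a single point, so that no edge of `γ` occurs in both words.
    have hdisj : ∀ k ∈ s₁, k ∉ s₂ := fun k hk₁ hk₂ => by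
      have : k.1.carrier ⊆ e₁.carrier ∩ e₂.carrier := by
        rw [hs₁, hs₂]
        exact subset_inter (subset_biUnion_of_mem (u := fun k : γ.edges => k.1.carrier) hk₁)
          (subset_biUnion_of_mem (u := fun k : γ.edges => k.1.carrier) hk₂)
      rw [hc.2.1] at this
      exact k.1.arc.infinite ((finite_singleton _).subset this)
    refine ⟨s₁ ∪ s₂, fun a => w₁ a * w₂ a, ?_, hw₁.mul hw₂,
      fun A => by rw [A.2.2 _ _ _ hc, hA₁, hA₂], ?_, ?_⟩
    · rw [hc.2.2.2.2, hs₁, hs₂, biUnion_union]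
    · intro k hk a x
      beta_reduce
      rw [h1₁ k fun h => hk (Or.inl h), h1₂ k fun h => hk (Or.inr h)]
    · rintro k hk a
      by_cases hk₁ : k ∈ s₁
      · obtain ⟨u, v, h | h⟩ := h2₁ k hk₁ a
        · exact ⟨u, v * w₂ a, Or.inl fun x => by beta_reduce; rw [h, h1₂ k (hdisj k hk₁)]; group⟩
        · exact ⟨u, v * w₂ a, Or.inr fun x => by beta_reduce; rw [h, h1₂ k (hdisj k hk₁)]; group⟩
      · obtain ⟨u, v, h | h⟩ := h2₂ k (hk.resolve_left hk₁) a
        · exact ⟨w₁ a * u, v, Or.inl fun x => by beta_reduce; rw [h, h1₁ k hk₁]; group⟩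
        · exact ⟨w₁ a * u, v, Or.inr fun x => by beta_reduce; rw [h, h1₁ k hk₁]; group⟩

end Graph

end Combinatorics

/-! ### Haar measure on a compact group -/

section Haar

variable {G : Type*} [Group G] [TopologicalSpace G] [IsTopologicalGroup G] [CompactSpace G]
  [MeasurableSpace G] [BorelSpace G]

instance : (haarProb G).IsHaarMeasure := Measure.isHaarMeasure_haarMeasure _

/-- Compact groups are unimodular. -/
instance : (haarProb G).IsMulRightInvariant where
  map_mul_right_eq_self g := by
    have : IsProbabilityMeasure (Measure.map (· * g) (haarProb G)) :=
      Measure.isProbabilityMeasure_map (measurable_mul_const g).aemeasurable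
    exact Measure.isHaarMeasure_eq_of_isProbabilityMeasure _ _

instance : (haarProb G).IsInvInvariant where
  inv_eq_self := by
    have : IsProbabilityMeasure (haarProb G).inv :=
      Measure.isProbabilityMeasure_map measurable_inv.aemeasurable
    have : (haarProb G).inv.IsHaarMeasure := { }
    exact Measure.isHaarMeasure_eq_of_isProbabilityMeasure _ _

theorem integral_haarProb_mul_mul (f : G → ℂ) (u v : G) :
    ∫ x, f (u * x * v) ∂haarProb G = ∫ x, f x ∂haarProb G := by
  rw [integral_mul_left_eq_self (fun x => f (x * v)) u, integral_mul_right_eq_self]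

theorem integral_haarProb_mul_inv_mul (f : G → ℂ) (u v : G) :
    ∫ x, f (u * x⁻¹ * v) ∂haarProb G = ∫ x, f x ∂haarProb G := by
  rw [integral_inv_eq_self (fun x => f (u * x * v)), integral_haarProb_mul_mul]

end Haar

/-- Resampling one coordinate preserves a product measure. -/
theorem measurePreserving_update {ι X : Type*} [Fintype ι] [DecidableEq ι] [MeasurableSpace X]
    (ν : Measure X) [IsProbabilityMeasure ν] (k : ι) :
    MeasurePreserving (fun p : (ι → X) × X => Function.update p.1 k p.2)
      ((Measure.pi fun _ => ν).prod ν) (Measure.pi fun _ => ν) := by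
  have hm : Measurable fun p : (ι → X) × X => Function.update p.1 k p.2 :=
    measurable_pi_lambda _ fun i => by
      by_cases h : i = k
      · subst h; simpa using measurable_snd
      · simpa [h] using measurable_fst.eval (a := i)
  refine ⟨hm, (Measure.pi_eq fun s hs => ?_).symm⟩
  rw [Measure.map_apply hm (MeasurableSet.univ_pi hs)]
  have : (fun p : (ι → X) × X => Function.update p.1 k p.2) ⁻¹' univ.pi s =
      (univ.pi (Function.update s k univ)) ×ˢ s k := by
    ext ⟨a, x⟩
    simp only [mem_preimage, mem_pi, mem_univ, true_imp_iff, mem_prod]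
    constructor
    · refine fun h => ⟨fun i => ?_, by simpa using h k⟩
      by_cases hi : i = k
      · subst hi; simp
      · simpa [hi] using h i
    · rintro ⟨h, hk⟩ i
      by_cases hi : i = k
      · subst hi; simpa using hk
      · simpa [hi] using h i
  rw [this, Measure.prod_prod, Measure.pi_pi, ← Finset.mul_prod_erase _ _ (Finset.mem_univ k),
    ← Finset.mul_prod_erase (s := Finset.univ) (a := k) (fun i => ν (s i)) (Finset.mem_univ k)]
  simp only [Function.update_self, measure_univ, one_mul]
  rw [mul_comm]
  congr 1
  exact Finset.prod_congr rfl fun i hi => by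
    rw [Function.update_of_ne (Finset.ne_of_mem_erase hi)]

/-- Integrate out one coordinate first. -/
theorem integral_pi_eq_integral_update {ι X : Type*} [Fintype ι] [DecidableEq ι]
    [MeasurableSpace X] (ν : Measure X) [IsProbabilityMeasure ν] (k : ι) {f : (ι → X) → ℂ}
    (hf : Integrable f (Measure.pi fun _ => ν)) :
    ∫ a, f a ∂(Measure.pi fun _ => ν) =
      ∫ a, ∫ x, f (Function.update a k x) ∂ν ∂(Measure.pi fun _ => ν) := by
  have h := measurePreserving_update ν k
  have h2 := integral_map (μ := (Measure.pi fun _ => ν).prod ν) h.measurable.aemeasurable (f := f)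
    (by rw [h.map_eq]; exact hf.aestronglyMeasurable)
  rw [h.map_eq] at h2
  rw [h2]
  exact integral_prod _ ((h.integrable_comp hf.aestronglyMeasurable).2 hf)

/-! ### Cylinder functions -/

section Cylinder

variable {S : Type*} [TopologicalSpace S] {C : EdgeCategory S}
  {G : Type*} [Group G] [TopologicalSpace G] [IsTopologicalGroup G] [CompactSpace G]
  [SecondCountableTopology G] [MeasurableSpace G] [BorelSpace G]

variable (μ : Measure (Conn C G)) [hμ : IsAshtekarLewandowski μ]

theorem memLp_cylinder (γ : Graph C) (F : C(γ.edges → G, ℂ)) :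
    MemLp (fun A => F (γ.eval A)) 2 μ := by
  have := hμ.isProbabilityMeasure
  exact MemLp.of_bound (F.continuous.measurable.comp (measurable_eval γ)).aestronglyMeasurable ‖F‖
    (.of_forall fun A => F.norm_coe_le_norm _)

/-- The state given by a continuous function of the holonomies along the edges of `γ`. -/
noncomputable def cylState (γ : Graph C) (F : C(γ.edges → G, ℂ)) : Lp ℂ 2 μ :=
  (memLp_cylinder μ γ F).toLp _

theorem coeFn_cylState (γ : Graph C) (F : C(γ.edges → G, ℂ)) :
    cylState μ γ F =ᵐ[μ] fun A => F (γ.eval A) := MemLp.coeFn_toLp _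

theorem mem_Cyl_iff {γ : Graph C} {f : Lp ℂ 2 μ} :
    f ∈ Cyl μ γ ↔ ∃ F : C(γ.edges → G, ℂ), γ.GaugeInvariant F ∧ f = cylState μ γ F := by
  constructor
  · rintro ⟨F, hF, h⟩
    exact ⟨F, hF, Lp.ext (h.trans (coeFn_cylState μ γ F).symm)⟩
  · rintro ⟨F, hF, rfl⟩
    exact ⟨F, hF, coeFn_cylState μ γ F⟩

theorem inner_cylState {α β : Graph C} (F : C(α.edges → G, ℂ)) (F' : C(β.edges → G, ℂ)) :
    inner ℂ (cylState μ α F) (cylState μ β F') =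
      ∫ A, star (F (α.eval A)) * F' (β.eval A) ∂μ := by
  rw [L2.inner_def]
  refine integral_congr_ae ?_
  filter_upwards [coeFn_cylState μ α F, coeFn_cylState μ β F'] with A h h'
  rw [h, h', RCLike.inner_apply, mul_comm]
  rfl

/-- The holonomies along the edges of `α`, given the one along `e` and those along the others. -/
def insertHol {α : Graph C} {e : Edge C} [DecidableEq (Edge C)]
    (x : G) (b : (α.erase e).edges → G) : α.edges → G :=
  fun k => if h : k.1 = e then x else b ⟨k, Graph.mem_erase.2 ⟨h, k.2⟩⟩

theorem continuous_insertHol {α : Graph C} {e : Edge C} [DecidableEq (Edge C)] :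
    Continuous fun p : ((α.erase e).edges → G) × G => (insertHol p.2 p.1 : α.edges → G) := by
  refine continuous_pi fun k => ?_
  by_cases h : k.1 = e
  · simpa [insertHol, h] using continuous_snd
  · simp only [insertHol, h, dite_false]
    fun_prop

/-- The average of a function of holonomies over the holonomy of one edge. -/
noncomputable def averageHol {α : Graph C} (e : Edge C) [DecidableEq (Edge C)]
    (F : C(α.edges → G, ℂ)) : C((α.erase e).edges → G, ℂ) where
  toFun b := ∫ x, F (insertHol x b) ∂haarProb G
  continuous_toFun := by
    have h := continuous_parametric_integral_of_continuous (μ := haarProb G)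
      (f := fun (b : (α.erase e).edges → G) x => F (insertHol x b))
      (F.continuous.comp continuous_insertHol) isCompact_univ
    simpa using h

theorem averageHol_gaugeInvariant {α : Graph C} (e : Edge C) [DecidableEq (Edge C)]
    {F : C(α.edges → G, ℂ)} (hF : α.GaugeInvariant F) :
    (α.erase e).GaugeInvariant (averageHol e F) := by
  intro g b
  change ∫ x, F (insertHol x _) ∂haarProb G = ∫ x, F (insertHol x b) ∂haarProb G
  rw [← integral_haarProb_mul_mul _ (g e.src)⁻¹ (g e.tgt)]
  refine integral_congr_ae (.of_forall fun x => ?_)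
  beta_reduce
  rw [← hF g (insertHol x b)]
  congr 1
  funext k
  by_cases h : k.1 = e
  · simp [insertHol, h]
  · simp [insertHol, h]

variable [T2Space S]

/-- If the edge `e` of `α` is not covered by `β`, then some piece of `e` is disjoint, up to
endpoints, from `β` and from the other edges of `α`. Its holonomy is independent of those along
`β` and occurs as one factor of the holonomy along `e`, so that averaging over it has the same
effect as averaging over the whole holonomy along `e`. -/
theorem integral_averageHol [DecidableEq (Edge C)] (μ : Measure (Conn C G))
    [hμ : IsAshtekarLewandowski μ] {α β : Graph C} {e : Edge C} (he : e ∈ α.edges)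
    (hβ : ¬ e.carrier ⊆ β.support) (F : C(α.edges → G, ℂ)) (F' : C(β.edges → G, ℂ)) :
    ∫ A, star (F (α.eval A)) * F' (β.eval A) ∂μ =
      ∫ A, star (averageHol e F ((α.erase e).eval A)) * F' (β.eval A) ∂μ := by
  obtain ⟨γ, hγ⟩ := exists_graph (α.edges ∪ β.edges)
  choose sα wα hsα hwα hAα h1α h2α using fun i : α.edges =>
    (hγ i (Finset.mem_union_left _ i.2)).exists_word (G := G)
  choose sβ wβ hsβ hwβ hAβ h1β h2β using fun i : β.edges =>
    (hγ i (Finset.mem_union_right _ i.2)).exists_word (G := G)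
  let i₀ : α.edges := ⟨e, he⟩
  obtain ⟨k, hk, hkβ⟩ : ∃ k ∈ sα i₀, ¬ k.1.carrier ⊆ β.support := by
    by_contra! h
    exact hβ ((hsα i₀).subset.trans (iUnion₂_subset h))
  have hkβ' : ∀ i, k ∉ sβ i := fun i hi => hkβ (by
    refine Subset.trans ?_ (Graph.carrier_subset_support i.2)
    rw [hsβ]
    exact subset_biUnion_of_mem (u := fun k : γ.edges => k.1.carrier) hi)
  have hkα : ∀ i, i ≠ i₀ → k ∉ sα i := fun i hi hki => by
    have : k.1.carrier ⊆ i.1.carrier ∩ e.carrier := by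
      rw [hsα, show e.carrier = _ from hsα i₀]
      exact subset_inter (subset_biUnion_of_mem (u := fun k : γ.edges => k.1.carrier) hki)
        (subset_biUnion_of_mem (u := fun k : γ.edges => k.1.carrier) hk)
    exact k.1.arc.infinite
      ((Graph.inter_finite i.2 he fun h => hi (Subtype.ext h)).subset this)
  let Wα : (γ.edges → G) → α.edges → G := fun a i => wα i a
  let Wα' : (γ.edges → G) → (α.erase e).edges → G := fun a i =>
    wα ⟨i.1, (Graph.mem_erase.1 i.2).2⟩ a
  let Wβ : (γ.edges → G) → β.edges → G := fun a i => wβ i a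
  have hWα : Measurable Wα := measurable_pi_lambda _ hwα
  have hWβ : Measurable Wβ := measurable_pi_lambda _ hwβ
  have hWα' : Measurable Wα' := measurable_pi_lambda _ fun i => hwα _
  have eα : ∀ A : Conn C G, α.eval A = Wα (γ.eval A) := fun A => funext fun i => hAα i A
  have eα' : ∀ A : Conn C G, (α.erase e).eval A = Wα' (γ.eval A) := fun A =>
    funext fun i => hAα ⟨i.1, (Graph.mem_erase.1 i.2).2⟩ A
  have eβ : ∀ A : Conn C G, β.eval A = Wβ (γ.eval A) := fun A => funext fun i => hAβ i A
  have hupd : ∀ a x, Wα (Function.update a k x) =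
      insertHol (wα i₀ (Function.update a k x)) (Wα' a) := fun a x => by
    funext i
    by_cases hi : i.1 = e
    · obtain rfl : i = i₀ := Subtype.ext hi
      simp [Wα, insertHol, hi]
    · have hi' : i ≠ i₀ := fun h => hi (congrArg Subtype.val h)
      simp only [Wα, insertHol, hi, dite_false, Wα']
      exact h1α i k (hkα i hi') a x
  have hupdβ : ∀ a x, Wβ (Function.update a k x) = Wβ a := fun a x =>
    funext fun i => h1β i k (hkβ' i) a x
  have hm : Measurable fun a => star (F (Wα a)) * F' (Wβ a) :=
    (continuous_star.measurable.comp (F.continuous.measurable.comp hWα)).mul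
      (F'.continuous.measurable.comp hWβ)
  have hm' : Measurable fun a => star (averageHol e F (Wα' a)) * F' (Wβ a) :=
    (continuous_star.measurable.comp ((averageHol e F).continuous.measurable.comp hWα')).mul
      (F'.continuous.measurable.comp hWβ)
  have hint : Integrable (fun a => star (F (Wα a)) * F' (Wβ a))
      (Measure.pi fun _ => haarProb G) :=
    Integrable.of_bound hm.aestronglyMeasurable (‖F‖ * ‖F'‖) (.of_forall fun a => by
      rw [norm_mul, norm_star]
      exact mul_le_mul (F.norm_coe_le_norm _) (F'.norm_coe_le_norm _) (norm_nonneg _)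
        (norm_nonneg _))
  have hL := integral_map (measurable_eval (G := G) γ).aemeasurable (μ := μ)
    (f := fun a => star (F (Wα a)) * F' (Wβ a)) hm.aestronglyMeasurable
  have hR := integral_map (measurable_eval (G := G) γ).aemeasurable (μ := μ)
    (f := fun a => star (averageHol e F (Wα' a)) * F' (Wβ a)) hm'.aestronglyMeasurable
  simp only [eα, eα', eβ]
  rw [← hL, ← hR, (hμ.eval γ).map_eq, integral_pi_eq_integral_update _ k hint]
  refine integral_congr_ae (.of_forall fun a => ?_)
  simp only [hupd, hupdβ]
  rw [integral_mul_const]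
  congr 1
  rw [show star (averageHol e F (Wα' a)) = ∫ x, star (F (insertHol x (Wα' a))) ∂haarProb G from
    integral_conj.symm]
  obtain ⟨u, v, h | h⟩ := h2α i₀ k hk a
  · simp only [h]
    exact integral_haarProb_mul_mul (fun x => star (F (insertHol x (Wα' a)))) u v
  · simp only [h]
    exact integral_haarProb_mul_inv_mul (fun x => star (F (insertHol x (Wα' a)))) u v

end Cylinder

/-! ### The action of diffeomorphisms -/

section Action

variable {S : Type*} [TopologicalSpace S] [T2Space S] {C : EdgeCategory S}
  {G : Type*} [Group G] [TopologicalSpace G] [IsTopologicalGroup G] [CompactSpace G]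
  [SecondCountableTopology G] [MeasurableSpace G] [BorelSpace G]
  {μ : Measure (Conn C G)} [hμ : IsAshtekarLewandowski μ]

theorem coeFn_U (φ : C.diff) (f : Lp ℂ 2 μ) : U μ φ f =ᵐ[μ] f ∘ Conn.pullback φ :=
  Lp.coeFn_compMeasurePreserving f (measurePreserving_pullback μ φ)

theorem U_one (f : Lp ℂ 2 μ) : U μ (1 : C.diff) f = f := by
  refine Lp.ext ((coeFn_U 1 f).trans (.of_forall fun A => ?_))
  have : Conn.pullback (1 : C.diff) A = A := Subtype.ext (funext fun e => by
    change A.1 (e.map 1) = A.1 e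
    rw [Edge.map_one])
  rw [Function.comp_apply, this]

theorem U_mul (φ ψ : C.diff) (f : Lp ℂ 2 μ) : U μ (φ * ψ) f = U μ φ (U μ ψ f) := by
  refine Lp.ext ((coeFn_U _ f).trans ((coeFn_U φ _).trans ?_).symm)
  have h := (measurePreserving_pullback μ φ).quasiMeasurePreserving.ae_eq (coeFn_U ψ f)
  refine h.trans (.of_forall fun A => ?_)
  have : Conn.pullback ψ (Conn.pullback φ A) = Conn.pullback (φ * ψ) A :=
    Subtype.ext (funext fun e => by
      change A.1 ((e.map ψ).map φ) = A.1 (e.map (φ * ψ))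
      rw [Edge.map_mul])
  simp only [Function.comp_apply, this]

theorem inner_U_left (φ : C.diff) (f h : Lp ℂ 2 μ) :
    inner ℂ (U μ φ f) h = inner ℂ f (U μ φ⁻¹ h) := by
  rw [← (U μ φ⁻¹).inner_map_map, ← U_mul, inv_mul_cancel, U_one]

/-- Only the unoriented edges matter: reversing an edge inverts its holonomy. -/
theorem U_mem_Cyl {φ : C.diff} {α γ : Graph C}
    (h : (fun K => φ.1 '' K) '' α.arcs ⊆ γ.arcs) {f : Lp ℂ 2 μ} (hf : f ∈ Cyl μ α) :
    U μ φ f ∈ Cyl μ γ := by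
  classical
  obtain ⟨F, hF, hfF⟩ := hf
  have hj : ∀ i : α.edges, ∃ j : γ.edges, i.1.map φ = j ∨ i.1.map φ = j.1.rev := fun i => by
    obtain ⟨k, hk, hkc⟩ := h ⟨_, ⟨i.1, i.2, rfl⟩, rfl⟩
    have harc := k.arc
    rw [hkc] at harc
    refine ⟨⟨k, hk⟩, ?_⟩
    rcases harc.endpoints (i.1.map φ).arc with ⟨h1, h2⟩ | ⟨h1, h2⟩
    · exact Or.inl (Edge.ext hkc.symm h1 h2)
    · exact Or.inr (Edge.ext hkc.symm h1 h2)
  choose j hj using hj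
  let W : (γ.edges → G) → α.edges → G := fun b i =>
    if i.1.map φ = j i then b (j i) else (b (j i))⁻¹
  have hW : Continuous W := continuous_pi fun i => by
    by_cases hi : i.1.map φ = j i
    · simp only [W, hi, if_true]; fun_prop
    · simp only [W, hi, if_false]; fun_prop
  refine ⟨F.comp ⟨W, hW⟩, fun g b => ?_, ?_⟩
  · simp only [ContinuousMap.comp_apply, ContinuousMap.coe_mk]
    rw [← hF (g ∘ φ.1) (W b)]
    congr 1
    funext i
    by_cases hi : i.1.map φ = j i
    · have h1 : φ.1 i.1.src = (j i).1.src := congrArg Edge.src hi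
      have h2 : φ.1 i.1.tgt = (j i).1.tgt := congrArg Edge.tgt hi
      simp only [W, hi, if_true, Function.comp_apply, h1, h2]
    · have hi' := (hj i).resolve_left hi
      have h1 : φ.1 i.1.src = (j i).1.tgt := congrArg Edge.src hi'
      have h2 : φ.1 i.1.tgt = (j i).1.src := congrArg Edge.tgt hi'
      simp only [W, hi, if_false, Function.comp_apply, h1, h2]
      group
  · have h1 := (measurePreserving_pullback μ φ).quasiMeasurePreserving.ae_eq hfF
    refine ((coeFn_U φ f).trans h1).trans (.of_forall fun A => ?_)
    change F (α.eval (Conn.pullback φ A)) = F (W (γ.eval A))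
    congr 1
    funext i
    change A.1 (i.1.map φ) = _
    by_cases hi : i.1.map φ = j i
    · simp only [W, hi, if_true]; rfl
    · simp only [W, hi, if_false]
      rw [(hj i).resolve_left hi, A.2.1]; rfl

theorem U_mem_Hgr {φ : C.diff} {α γ : Graph C}
    (h : (fun K => φ.1 '' K) '' α.arcs ⊆ γ.arcs) {f : Lp ℂ 2 μ} (hf : f ∈ Hgr μ α) :
    U μ φ f ∈ Hgr μ γ :=
  map_mem_closure (U μ φ).continuous hf fun _ hg => U_mem_Cyl h hg

theorem Hgr_mono {α γ : Graph C} (h : α ≤ γ) : Hgr μ α ≤ Hgr μ γ := fun f hf => by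
  rw [← U_one f]
  refine U_mem_Hgr ?_ hf
  change (fun K => id '' K) '' α.arcs ⊆ γ.arcs
  simpa using Graph.arcs_mono h

theorem U_mem_Hgr_map (φ : C.diff) {β : Graph C} {f : Lp ℂ 2 μ} (hf : f ∈ Hgr μ β) :
    U μ φ f ∈ Hgr μ (β.map φ) :=
  U_mem_Hgr (Graph.map_arcs φ β).superset hf

/-- A diffeomorphism that fixes every oriented edge of `γ` acts trivially on `H_γ`. -/
theorem U_eq_self_of_fixes {φ : C.diff} {γ : Graph C} (h : ∀ e ∈ γ.edges, e.map φ = e)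
    {f : Lp ℂ 2 μ} (hf : f ∈ Hgr μ γ) : U μ φ f = f := by
  have hcl : IsClosed {f : Lp ℂ 2 μ | U μ φ f = f} :=
    isClosed_eq (U μ φ).continuous continuous_id
  refine closure_minimal ?_ hcl hf
  rintro f ⟨F, -, hfF⟩
  have h1 := (measurePreserving_pullback μ φ).quasiMeasurePreserving.ae_eq hfF
  refine Lp.ext (((coeFn_U φ f).trans h1).trans
    (Filter.EventuallyEq.trans (.of_forall fun A => ?_) hfF.symm))
  change F (γ.eval (Conn.pullback φ A)) = F (γ.eval A)
  congr 1
  funext i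
  change A.1 (i.1.map φ) = A.1 i
  rw [h i.1 i.2]

end Action

/-! ### Orthogonality of the spaces `H'_α` -/

section Orthogonality

variable {S : Type*} [TopologicalSpace S] [T2Space S] {C : EdgeCategory S}
  {G : Type*} [Group G] [TopologicalSpace G] [IsTopologicalGroup G] [CompactSpace G]
  [SecondCountableTopology G] [MeasurableSpace G] [BorelSpace G]
  {μ : Measure (Conn C G)} [hμ : IsAshtekarLewandowski μ]

theorem inner_eq_zero_of_mem_closure {β : Graph C} {Ψ : Lp ℂ 2 μ}
    (h : ∀ f ∈ Cyl μ β, inner ℂ Ψ f = 0) {f : Lp ℂ 2 μ} (hf : f ∈ Hgr μ β) :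
    inner ℂ Ψ f = 0 :=
  closure_minimal (s := (Cyl μ β : Set (Lp ℂ 2 μ))) (t := {f | inner ℂ Ψ f = 0}) h
    (isClosed_eq (by fun_prop) continuous_const) hf

/-- If the edge `e` of `α` is not covered by `β`, then a state of `H_α` has the same inner products
with `H_β` as its projection to `H_{α \ e}`. -/
theorem inner_sub_starProjection {α β : Graph C} {e : Edge C} (he : e ∈ α.edges)
    (hβ : ¬ e.carrier ⊆ β.support) {Ψ f : Lp ℂ 2 μ} (hΨ : Ψ ∈ Hgr μ α) (hf : f ∈ Hgr μ β) :
    inner ℂ (Ψ - (Hgr μ (α.erase e)).starProjection Ψ) f = 0 := by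
  classical
  let T : Lp ℂ 2 μ →L[ℂ] Lp ℂ 2 μ :=
    ContinuousLinearMap.id ℂ _ - (Hgr μ (α.erase e)).starProjection
  refine closure_minimal (s := (Cyl μ α : Set (Lp ℂ 2 μ))) (t := {Ψ | inner ℂ (T Ψ) f = 0}) ?_
    (isClosed_eq (by fun_prop) continuous_const) hΨ
  intro Ψ hΨ
  obtain ⟨F, hF, rfl⟩ := (mem_Cyl_iff μ).1 hΨ
  have key : ∀ δ : Graph C, ¬ e.carrier ⊆ δ.support → ∀ h ∈ Hgr μ δ,
      inner ℂ (cylState μ α F - cylState μ (α.erase e) (averageHol e F)) h = 0 := by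
    intro δ hδ h hh
    refine inner_eq_zero_of_mem_closure (fun h hh => ?_) hh
    obtain ⟨F', -, rfl⟩ := (mem_Cyl_iff μ).1 hh
    rw [inner_sub_left, inner_cylState, inner_cylState, integral_averageHol μ he hδ, sub_self]
  -- By the case `δ = α \ e`, the average is the projection of the state to `H_{α \ e}`.
  have hmem : cylState μ (α.erase e) (averageHol e F) ∈ Hgr μ (α.erase e) :=
    (Cyl μ _).le_topologicalClosure
      ((mem_Cyl_iff μ).2 ⟨_, averageHol_gaugeInvariant e hF, rfl⟩)
  have hproj : (Hgr μ (α.erase e)).starProjection (cylState μ α F) =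
      cylState μ (α.erase e) (averageHol e F) :=
    (Submodule.eq_starProjection_of_mem_of_inner_eq_zero hmem
      (key _ (Graph.not_carrier_subset_support_erase he)))
  change inner ℂ (cylState μ α F - (Hgr μ (α.erase e)).starProjection (cylState μ α F)) f = 0
  rw [hproj]
  exact key β hβ f hf

/-- `H'_α` is orthogonal to `H_β` unless `β` covers `α`. -/
theorem inner_eq_zero_of_not_support_subset {α β : Graph C} (h : ¬ α.support ⊆ β.support)
    {Ψ f : Lp ℂ 2 μ} (hΨ : Ψ ∈ Hgr' μ α) (hf : f ∈ Hgr μ β) : inner ℂ Ψ f = 0 := by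
  obtain ⟨e, he, hβ⟩ : ∃ e ∈ α.edges, ¬ e.carrier ⊆ β.support := by
    by_contra! h'
    exact h (iUnion₂_subset h')
  have h1 := inner_sub_starProjection he hβ hΨ.1 hf
  have h2 : (Hgr μ (α.erase e)).starProjection Ψ = 0 := by
    rw [Submodule.starProjection_apply_eq_zero_iff]
    refine Submodule.orthogonal_le ?_ hΨ.2
    exact le_iSup₂_of_le (α.erase e) (Graph.erase_lt he) le_rfl
  rwa [h2, sub_zero] at h1

theorem mem_Hgr'_of_forall_lt {α : Graph C} {Ψ : Lp ℂ 2 μ} (hΨ : Ψ ∈ Hgr μ α)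
    (h : ∀ β < α, ∀ f ∈ Hgr μ β, inner ℂ Ψ f = 0) : Ψ ∈ Hgr' μ α := by
  refine ⟨hΨ, ?_⟩
  have hle : ⨆ (β : Graph C) (_ : β < α), Hgr μ β ≤ (ℂ ∙ Ψ)ᗮ := iSup₂_le fun β hβ f hf =>
    Submodule.mem_orthogonal_singleton_iff_inner_right.2 (h β hβ f hf)
  exact (Submodule.mem_orthogonal' _ _).2 fun u hu =>
    Submodule.mem_orthogonal_singleton_iff_inner_right.1 (hle hu)

/-- Unlike the definition, this description of `H'_α` is manifestly covariant under
diffeomorphisms. -/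
theorem mem_Hgr'_iff {α : Graph C} {Ψ : Lp ℂ 2 μ} : Ψ ∈ Hgr' μ α ↔ Ψ ∈ Hgr μ α ∧
    ∀ β : Graph C, ¬ α.support ⊆ β.support → ∀ f ∈ Hgr μ β, inner ℂ Ψ f = 0 := by
  refine ⟨fun h => ⟨h.1, fun β hβ f hf => inner_eq_zero_of_not_support_subset hβ h hf⟩,
    fun h => mem_Hgr'_of_forall_lt h.1 fun β hβ => h.2 β fun hsub => hβ.not_ge ?_⟩
  exact Graph.le_of_support_subset le_rfl hβ.le hsub

theorem inner_eq_zero_of_support_ne {α β : Graph C} (h : α.support ≠ β.support)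
    {Ψ f : Lp ℂ 2 μ} (hΨ : Ψ ∈ Hgr' μ α) (hf : f ∈ Hgr' μ β) : inner ℂ Ψ f = 0 := by
  by_cases h1 : α.support ⊆ β.support
  · rw [← inner_conj_symm, inner_eq_zero_of_not_support_subset (fun h2 => h (h1.antisymm h2)) hf
      hΨ.1, map_zero]
  · exact inner_eq_zero_of_not_support_subset h1 hΨ hf.1

theorem proj'_mem (α : Graph C) (f : Lp ℂ 2 μ) : proj' μ α f ∈ Hgr' μ α :=
  Submodule.starProjection_apply_mem _ f

/-- The space `H_γ` is the orthogonal sum of the spaces `H'_β` of the subgraphs of `γ`. -/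
theorem sum_proj'_eq {γ : Graph C} {f : Lp ℂ 2 μ} (hf : f ∈ Hgr μ γ) :
    ∑ β ∈ γ.subgraphs, proj' μ β f = f := by
  let g := f - ∑ β ∈ γ.subgraphs, proj' μ β f
  have hg : g ∈ Hgr μ γ := sub_mem hf (sum_mem fun β hβ =>
    Hgr_mono (Graph.mem_subgraphs.1 hβ) (proj'_mem β f).1)
  -- The remainder `g` is orthogonal to all the spaces `H'_β`.
  have h1 : ∀ β ≤ γ, ∀ h ∈ Hgr' μ β, inner ℂ g h = 0 := by
    intro β hβ h hh
    have h2 : ∑ δ ∈ γ.subgraphs, inner ℂ (proj' μ δ f) h = inner ℂ (proj' μ β f) h := by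
      refine Finset.sum_eq_single_of_mem β (Graph.mem_subgraphs.2 hβ) fun δ hδ hne => ?_
      refine inner_eq_zero_of_support_ne (fun hs => hne ?_) (proj'_mem δ f) hh
      have hδ := Graph.mem_subgraphs.1 hδ
      exact (Graph.le_of_support_subset hδ hβ hs.subset).antisymm
        (Graph.le_of_support_subset hβ hδ hs.superset)
    rw [inner_sub_left, sum_inner, h2, ← inner_sub_left]
    exact Submodule.starProjection_inner_eq_zero f h hh
  -- Hence its projection to `H_β` lies in `H'_β` and vanishes, by induction on the subgraph `β`.
  have h2 : ∀ β ≤ γ, ∀ h ∈ Hgr μ β, inner ℂ g h = 0 := by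
    intro β
    induction β using Graph.wellFounded_lt.induction with
    | _ β ih =>
      intro hβ
      have hp : ∀ h ∈ Hgr μ β, inner ℂ ((Hgr μ β).starProjection g) h = inner ℂ g h := by
        intro h hh
        have := Submodule.starProjection_inner_eq_zero (K := Hgr μ β) g h hh
        rw [inner_sub_left, sub_eq_zero] at this
        exact this.symm
      have hmem : (Hgr μ β).starProjection g ∈ Hgr' μ β :=
        mem_Hgr'_of_forall_lt (Submodule.starProjection_apply_mem _ g) fun δ hδ h hh => by
          rw [hp h (Hgr_mono hδ.le hh), ih δ hδ (hδ.le.trans hβ) h hh]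
      have h0 : (Hgr μ β).starProjection g = 0 := by
        rw [← inner_self_eq_zero (𝕜 := ℂ), hp _ hmem.1, h1 β hβ _ hmem]
      intro h hh
      rw [← hp h hh, h0, inner_zero_left]
  have h3 : g = 0 := (inner_self_eq_zero (𝕜 := ℂ)).1 (h2 γ le_rfl g hg)
  exact (sub_eq_zero.1 h3).symm

theorem U_mem_Hgr' {φ : C.diff} {α γ : Graph C} (h : (fun K => φ.1 '' K) '' α.arcs = γ.arcs)
    {Ψ : Lp ℂ 2 μ} (hΨ : Ψ ∈ Hgr' μ α) : U μ φ Ψ ∈ Hgr' μ γ := by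
  rw [mem_Hgr'_iff] at hΨ ⊢
  refine ⟨U_mem_Hgr h.subset hΨ.1, fun β hβ f hf => ?_⟩
  rw [inner_U_left]
  refine hΨ.2 (β.map φ⁻¹) (fun hsub => hβ ?_) _ (U_mem_Hgr_map φ⁻¹ hf)
  rw [Graph.map_support] at hsub
  rw [Graph.support_eq_sUnion_arcs, ← h, ← image_sUnion, ← Graph.support_eq_sUnion_arcs]
  rintro _ ⟨x, hx, rfl⟩
  obtain ⟨y, hy, rfl⟩ := hsub hx
  have : φ.1 ((φ⁻¹).1 y) = y := φ.1.apply_symm_apply y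
  rwa [this]

end Orthogonality

/-! ### The rigging map -/

section Rigging

namespace Graph

variable {S : Type*} [TopologicalSpace S] {C : EdgeCategory S}

theorem embeddings_mono {α γ γ' : Graph C} (h : γ ≤ γ') : embeddings α γ ⊆ embeddings α γ' := by
  rintro _ ⟨φ, rfl, β, hβ, hφ⟩
  exact ⟨φ, rfl, β, hβ.trans h, hφ⟩

/-- If the self-embeddings of `α` form finitely many classes modulo `Diff_α`, then so do the
diffeomorphisms mapping `α` onto any given set. -/
theorem finite_image_support_eq {α : Graph C} (hfin : (embeddings α α).Finite) (K : Set S) :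
    {q : C.diff ⧸ α.Diff | q.out.1 '' α.support = K}.Finite := by
  rcases eq_empty_or_nonempty {q : C.diff ⧸ α.Diff | q.out.1 '' α.support = K} with h | ⟨q₀, h₀⟩
  · rw [h]; exact finite_empty
  · refine (hfin.preimage (f := fun q => q₀.out⁻¹ • q)
      (MulAction.injective (q₀.out⁻¹)).injOn).subset fun q hq => ?_
    refine ⟨q₀.out⁻¹ * q.out, ?_, α, le_rfl, ?_⟩
    · conv_rhs => rw [← QuotientGroup.out_eq' q]
      rfl
    · change (q₀.out.1.symm ∘ q.out.1) '' α.support = α.support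
      rw [mem_ofPred_eq] at hq h₀
      rw [image_comp, hq, ← h₀, ← image_comp]
      simp

variable [T2Space S]

theorem coe_mem_embeddings {α γ : Graph C} (hα : α ≤ γ) (g : γ.Diff) :
    ((g : C.diff) : C.diff ⧸ α.Diff) ∈ embeddings α γ :=
  ⟨g, rfl, exists_image_subgraph hα g.2⟩

/-- The class modulo `Diff_α` of a symmetry of `γ` depends only on the element of `GS_γ` that it
represents, for every subgraph `α` of `γ`. -/
theorem coe_out_eq {α γ : Graph C} (hα : α ≤ γ) (g : γ.Diff) :
    (((g : γ.GS).out : C.diff) : C.diff ⧸ α.Diff) = ((g : C.diff) : C.diff ⧸ α.Diff) :=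
  QuotientGroup.eq.2 (mem_diff_of_fixes hα (out_inv_mul_mem_tDiff g))

theorem EmbeddingsAreSymmetries.finite {α γ : Graph C} (h : γ.EmbeddingsAreSymmetries)
    (hα : α ≤ γ) : (embeddings α γ).Finite := by
  refine (finite_range fun k : γ.GS => ((k.out : C.diff) : C.diff ⧸ α.Diff)).subset ?_
  intro q hq
  obtain ⟨g, hg, rfl⟩ := h α hα q hq
  exact ⟨((⟨g, hg⟩ : γ.Diff) : γ.GS), coe_out_eq hα ⟨g, hg⟩⟩

end Graph

variable {S : Type*} [TopologicalSpace S] [T2Space S] {C : EdgeCategory S}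
  {G : Type*} [Group G] [TopologicalSpace G] [IsTopologicalGroup G] [CompactSpace G]
  [SecondCountableTopology G] [MeasurableSpace G] [BorelSpace G]
  {μ : Measure (Conn C G)} [hμ : IsAshtekarLewandowski μ]

theorem U_out {γ : Graph C} {f : Lp ℂ 2 μ} (hf : f ∈ Hgr μ γ) (g : γ.Diff) :
    U μ ((g : γ.GS).out : γ.Diff) f = U μ g f := by
  have h := U_eq_self_of_fixes (Graph.out_inv_mul_mem_tDiff g) hf
  conv_rhs => rw [← mul_inv_cancel_left ((g : γ.GS).out) g]
  rw [Subgroup.coe_mul, U_mul, h]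

theorem symAverage_eq [∀ γ : Graph C, Fintype γ.GS] (γ : Graph C) (Ψ : Lp ℂ 2 μ) :
    symAverage μ γ Ψ = (Nat.card γ.GS : ℂ)⁻¹ • ∑ g : γ.GS, U μ (g.out : γ.Diff) Ψ := by
  rw [symAverage, finsum_eq_sum_of_fintype]

theorem symAverage_mem {γ : Graph C} {Ψ : Lp ℂ 2 μ} (hΨ : Ψ ∈ Hgr' μ γ) :
    symAverage μ γ Ψ ∈ Hgr' μ γ := by
  have : ∀ γ : Graph C, Fintype γ.GS := fun γ => Fintype.ofFinite _
  rw [symAverage_eq]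
  exact Submodule.smul_mem _ _ (sum_mem fun g _ => U_mem_Hgr' (Graph.image_arcs g.out.2) hΨ)

theorem U_symAverage {γ : Graph C} {Ψ : Lp ℂ 2 μ} (hΨ : Ψ ∈ Hgr' μ γ) {ψ : C.diff}
    (hψ : ψ ∈ γ.Diff) : U μ ψ (symAverage μ γ Ψ) = symAverage μ γ Ψ := by
  have : ∀ γ : Graph C, Fintype γ.GS := fun γ => Fintype.ofFinite _
  rw [symAverage_eq, map_smul, map_sum]
  congr 1
  refine Fintype.sum_equiv (Equiv.mulLeft ((⟨ψ, hψ⟩ : γ.Diff) : γ.GS)) _ _ fun g => ?_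
  have hg : ((⟨ψ, hψ⟩ : γ.Diff) : γ.GS) * g = ((⟨ψ, hψ⟩ * g.out : γ.Diff) : γ.GS) := by
    conv_lhs => rw [← QuotientGroup.out_eq' g]
    rfl
  simp only [Equiv.coe_mulLeft]
  rw [hg, U_out hΨ.1, Subgroup.coe_mul, U_mul]

/-- The summands of the rigging map do not depend on the choice of representatives. -/
theorem U_out_symAverage {γ : Graph C} {Ψ : Lp ℂ 2 μ} (hΨ : Ψ ∈ Hgr' μ γ) (φ : C.diff) :
    U μ (φ : C.diff ⧸ γ.Diff).out (symAverage μ γ Ψ) = U μ φ (symAverage μ γ Ψ) := by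
  have h : (φ : C.diff ⧸ γ.Diff).out⁻¹ * φ ∈ γ.Diff :=
    QuotientGroup.eq.1 (Quotient.out_eq' (φ : C.diff ⧸ γ.Diff))
  conv_rhs => rw [← mul_inv_cancel_left (φ : C.diff ⧸ γ.Diff).out φ]
  rw [U_mul, U_symAverage hΨ h]

theorem exists_subgraph_of_inner_ne_zero {α γ : Graph C} {Ψ f : Lp ℂ 2 μ} (hΨ : Ψ ∈ Hgr' μ α)
    (hf : f ∈ Hgr μ γ) {φ : C.diff} (h : inner ℂ (U μ φ Ψ) f ≠ 0) :
    ∃ δ ≤ γ, φ.1 '' α.support = δ.support := by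
  rw [← sum_proj'_eq hf, inner_sum] at h
  obtain ⟨δ, hδ, hne⟩ := Finset.exists_ne_zero_of_sum_ne_zero h
  refine ⟨δ, Graph.mem_subgraphs.1 hδ, ?_⟩
  by_contra hs
  rw [← Graph.map_support] at hs
  exact hne (inner_eq_zero_of_support_ne hs (U_mem_Hgr' (Graph.map_arcs φ α).symm hΨ)
    (proj'_mem δ f))

/-- Only finitely many summands of the rigging map are nonzero. -/
theorem finite_support_rigging {α : Graph C} (hfin : (Graph.embeddings α α).Finite)
    {Ψ : Lp ℂ 2 μ} (hΨ : Ψ ∈ Hgr' μ α) {f : Lp ℂ 2 μ} (hf : f ∈ CylSpace μ) :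
    (Function.support fun q : C.diff ⧸ α.Diff => inner ℂ (U μ q.out Ψ) f).Finite := by
  induction hf using Submodule.iSup_induction' with
  | mem γ f hf =>
    refine ((γ.subgraphs.finite_toSet).biUnion fun δ _ =>
      Graph.finite_image_support_eq hfin δ.support).subset fun q hq => ?_
    obtain ⟨δ, hδ, h⟩ := exists_subgraph_of_inner_ne_zero hΨ hf hq
    exact mem_biUnion (Graph.mem_subgraphs.2 hδ) h
  | zero => simp
  | add f f' _ _ h h' =>
    simp only [inner_add_right]
    exact (h.union h').subset (Function.support_add _ _)

/-- The rigging map: if the self-embeddings of `α` form finitely many classes, then `η(Ψ)` is a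
well-defined diffeomorphism invariant functional. -/
theorem exists_isRigged {α : Graph C} (hfin : (Graph.embeddings α α).Finite) {Ψ : Lp ℂ 2 μ}
    (hΨ : Ψ ∈ Hgr' μ α) : ∃ L ∈ Hdiff μ, IsRigged μ α Ψ L := by
  have hsum : ∀ f : CylSpace μ, Summable fun q : C.diff ⧸ α.Diff =>
      inner ℂ (U μ q.out (symAverage μ α Ψ)) (f : Lp ℂ 2 μ) := fun f =>
    summable_of_hasFiniteSupport (finite_support_rigging hfin (symAverage_mem hΨ) f.2)
  let L : Module.Dual ℂ (CylSpace μ) :=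
    { toFun := fun f => ∑' q : C.diff ⧸ α.Diff,
        inner ℂ (U μ q.out (symAverage μ α Ψ)) (f : Lp ℂ 2 μ)
      map_add' := fun f f' => by
        simp only [Submodule.coe_add, inner_add_right]
        exact (hsum f).tsum_add (hsum f')
      map_smul' := fun c f => by
        simp only [Submodule.coe_smul, inner_smul_right, tsum_mul_left, smul_eq_mul,
          RingHom.id_apply] }
  refine ⟨L, fun ψ f f' e => ?_, fun f => (hsum f).hasSum⟩
  change ∑' q : C.diff ⧸ α.Diff, inner ℂ (U μ q.out (symAverage μ α Ψ)) (f' : Lp ℂ 2 μ) =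
    ∑' q : C.diff ⧸ α.Diff, inner ℂ (U μ q.out (symAverage μ α Ψ)) (f : Lp ℂ 2 μ)
  rw [e, ← (MulAction.toPerm ψ).tsum_eq]
  refine tsum_congr fun q => ?_
  have hq : MulAction.toPerm ψ q = ((ψ * q.out : C.diff) : C.diff ⧸ α.Diff) := by
    conv_lhs => rw [← QuotientGroup.out_eq' q]
    rfl
  rw [hq, U_out_symAverage hΨ, U_mul, LinearIsometry.inner_map_map]

end Rigging

/-! ### Averaging over the symmetries of the ambient graph -/

section Averaging

variable {S : Type*} [TopologicalSpace S] [T2Space S] {C : EdgeCategory S}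

/-- Multiplication by a symmetry of `γ`, on the classes modulo `Diff_α` that symmetries of `γ`
represent. -/
theorem Graph.coe_out_mul {α γ : Graph C} (hα : α ≤ γ) (g : γ.Diff) (k : γ.GS) :
    ((((g : γ.GS) * k).out : C.diff) : C.diff ⧸ α.Diff) =
      (g : C.diff) • ((k.out : C.diff) : C.diff ⧸ α.Diff) := by
  have h : (g : γ.GS) * k = ((g * k.out : γ.Diff) : γ.GS) := by
    conv_lhs => rw [← QuotientGroup.out_eq' k]
    rfl
  rw [h, Graph.coe_out_eq hα]
  rfl

/-- If all embeddings of `α` into `γ` are realized by symmetries of `γ`, then `GS_γ` acts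
transitively on them, so that averages over the embeddings are averages over `GS_γ`. -/
theorem Graph.EmbeddingsAreSymmetries.average_eq {α γ : Graph C} [Fintype γ.GS]
    (hemb : γ.EmbeddingsAreSymmetries) (hα : α ≤ γ) (s : Finset (C.diff ⧸ α.Diff))
    (hs : (s : Set (C.diff ⧸ α.Diff)) = Graph.embeddings α γ) (Φ : C.diff ⧸ α.Diff → ℂ) :
    (α.numEmbeddings γ : ℂ)⁻¹ * ∑ q ∈ s, Φ q =
      (Nat.card γ.GS : ℂ)⁻¹ * ∑ k : γ.GS, Φ (k.out : C.diff) := by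
  classical
  let π : γ.GS → C.diff ⧸ α.Diff := fun k => ((k.out : C.diff) : C.diff ⧸ α.Diff)
  have hπ : ∀ k ∈ (Finset.univ : Finset γ.GS), π k ∈ s := fun k _ => by
    rw [← Finset.mem_coe, hs]; exact Graph.coe_mem_embeddings hα k.out
  -- The fibres of `GS_γ` over the embeddings are translates of each other.
  let c := (Finset.univ.filter fun k => π k = ((1 : C.diff) : C.diff ⧸ α.Diff)).card
  have hc : ∀ q ∈ s, (Finset.univ.filter fun k => π k = q).card = c := fun q hq => by
    rw [← Finset.mem_coe, hs] at hq
    obtain ⟨g, hg, rfl⟩ := hemb α hα q hq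
    symm
    refine Finset.card_equiv (Equiv.mulLeft ((⟨g, hg⟩ : γ.Diff) : γ.GS)) fun k => ?_
    have h1 : (g : C.diff ⧸ α.Diff) = g • ((1 : C.diff) : C.diff ⧸ α.Diff) := by
      conv_lhs => rw [← mul_one g]
      rfl
    simp only [Finset.mem_filter, Finset.mem_univ, true_and, Equiv.coe_mulLeft, π]
    rw [Graph.coe_out_mul hα, h1]
    exact (smul_left_cancel_iff g).symm
  have hn : α.numEmbeddings γ = s.card := by
    rw [Graph.numEmbeddings, ← hs, ncard_coe_finset]
  have hcard : Nat.card γ.GS = s.card * c := by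
    rw [Nat.card_eq_fintype_card, ← Finset.card_univ, Finset.card_eq_sum_card_fiberwise hπ,
      Finset.sum_congr rfl hc, Finset.sum_const, smul_eq_mul]
  have hsum : ∑ k : γ.GS, Φ (π k) = c * ∑ q ∈ s, Φ q := by
    rw [← Finset.sum_fiberwise_of_maps_to hπ, Finset.mul_sum]
    refine Finset.sum_congr rfl fun q hq => ?_
    rw [Finset.sum_congr rfl fun k hk => congrArg Φ (Finset.mem_filter.1 hk).2, Finset.sum_const,
      hc q hq, nsmul_eq_mul]
  have h0 : (Nat.card γ.GS : ℂ) ≠ 0 := Nat.cast_ne_zero.2 Nat.card_pos.ne'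
  rw [hn]
  change _ = _ * ∑ k : γ.GS, Φ (π k)
  rw [hsum]
  rw [hcard, Nat.cast_mul] at h0 ⊢
  have := left_ne_zero_of_mul h0
  have := right_ne_zero_of_mul h0
  field_simp

variable {G : Type*} [Group G] [TopologicalSpace G] [IsTopologicalGroup G] [CompactSpace G]
  [SecondCountableTopology G] [MeasurableSpace G] [BorelSpace G]
  {μ : Measure (Conn C G)} [hμ : IsAshtekarLewandowski μ]

/-- If the symmetries of `α` extend to symmetries of `γ`, then averaging over `GS_γ` absorbs the
average over `GS_α`. -/
theorem sum_inner_U_symAverage {α γ : Graph C} [∀ γ : Graph C, Fintype γ.GS]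
    (hsym : γ.SymmetriesExtend) (hα : α ≤ γ) {Ψ : Lp ℂ 2 μ} (hΨ : Ψ ∈ Hgr' μ α) (h : Lp ℂ 2 μ) :
    ∑ k : γ.GS, inner ℂ (U μ (k.out : γ.Diff) (symAverage μ α Ψ)) h =
      ∑ k : γ.GS, inner ℂ (U μ (k.out : γ.Diff) Ψ) h := by
  have key : ∀ q : α.GS, ∑ k : γ.GS, inner ℂ (U μ (k.out : γ.Diff) (U μ (q.out : α.Diff) Ψ)) h =
      ∑ k : γ.GS, inner ℂ (U μ (k.out : γ.Diff) Ψ) h := by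
    intro q
    obtain ⟨g, hg, hgα, rfl⟩ := hsym α hα q
    rw [U_out hΨ.1]
    refine Fintype.sum_equiv (Equiv.mulRight ((⟨g, hg⟩ : γ.Diff) : γ.GS)) _ _ fun k => ?_
    have hk : k * ((⟨g, hg⟩ : γ.Diff) : γ.GS) = ((k.out * ⟨g, hg⟩ : γ.Diff) : γ.GS) := by
      conv_lhs => rw [← QuotientGroup.out_eq' k]
      rfl
    simp only [Equiv.coe_mulRight]
    rw [hk, U_out (Hgr_mono hα hΨ.1), Subgroup.coe_mul, U_mul]
  have h0 : (Nat.card α.GS : ℂ) ≠ 0 := Nat.cast_ne_zero.2 Nat.card_pos.ne'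
  simp only [symAverage_eq, map_smul, map_sum, inner_smul_left, sum_inner, map_inv₀,
    Complex.conj_natCast]
  rw [← Finset.mul_sum, Finset.sum_comm, Finset.sum_congr rfl fun q _ => key q, Finset.sum_const,
    Finset.card_univ, nsmul_eq_mul, ← Nat.card_eq_fintype_card, inv_mul_cancel_left₀ h0]

/-- On `H_γ`, the rigged state `η(Ψ)` is, up to the factor `n(α, γ)`, the average of `Ψ` over the
symmetries of `γ`. -/
theorem IsRigged.apply_eq {α γ : Graph C} [∀ γ : Graph C, Fintype γ.GS]
    (hsym : γ.SymmetriesExtend) (hemb : γ.EmbeddingsAreSymmetries) (hα : α ≤ γ)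
    {Ψ : Lp ℂ 2 μ} (hΨ : Ψ ∈ Hgr' μ α) {L : Module.Dual ℂ (CylSpace μ)} (hL : IsRigged μ α Ψ L)
    (h : CylSpace μ) (hh : (h : Lp ℂ 2 μ) ∈ Hgr μ γ) :
    (α.numEmbeddings γ : ℂ)⁻¹ * L h =
      (Nat.card γ.GS : ℂ)⁻¹ * ∑ k : γ.GS, inner ℂ (U μ (k.out : γ.Diff) Ψ) (h : Lp ℂ 2 μ) := by
  have hfin := hemb.finite hα
  have hLs : L h = ∑ q ∈ hfin.toFinset,
      inner ℂ (U μ q.out (symAverage μ α Ψ)) (h : Lp ℂ 2 μ) := by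
    refine (hL h).unique (hasSum_sum_of_ne_finset_zero fun q hq => ?_)
    by_contra hne
    obtain ⟨δ, hδ, hs⟩ := exists_subgraph_of_inner_ne_zero (symAverage_mem hΨ) hh hne
    exact hq (hfin.mem_toFinset.2 ⟨q.out, QuotientGroup.out_eq' q, δ, hδ, hs⟩)
  rw [hLs, hemb.average_eq hα _ hfin.coe_toFinset, ← sum_inner_U_symAverage hsym hα hΨ]
  simp only [U_out_symAverage hΨ]

end Averaging

/-! ### The quadratic operator -/

section Quadratic

variable {E : Type*} [NormedAddCommGroup E] [InnerProductSpace ℂ E]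

/-- The values of a sum of partially defined operators, in terms of graphs. -/
theorem exists_of_mem_graph_sum {ι : Type*} (s : Finset ι) (T : ι → E →ₗ.[ℂ] E) {x z : E}
    (h : (x, z) ∈ (∑ v ∈ s, T v).graph) :
    ∃ y : ι → E, z = ∑ v ∈ s, y v ∧ ∀ v ∈ s, (x, y v) ∈ (T v).graph := by
  classical
  induction s using Finset.induction_on generalizing z with
  | empty =>
    obtain ⟨x', hx, hz⟩ := (LinearPMap.mem_graph_iff _).1 h
    exact ⟨0, hz.symm, by simp⟩
  | insert a s ha ih =>
    rw [Finset.sum_insert ha] at h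
    obtain ⟨⟨x', hx⟩, hxx, hz⟩ := (LinearPMap.mem_graph_iff _).1 h
    obtain rfl : x' = x := hxx
    obtain ⟨y, hy, hyg⟩ := ih (LinearPMap.mem_graph (∑ v ∈ s, T v) ⟨x', hx.2⟩)
    refine ⟨Function.update y a (T a ⟨x', hx.1⟩), ?_, fun v hv => ?_⟩
    · rw [Finset.sum_insert ha, Function.update_self, Finset.sum_update_of_notMem ha, ← hy]
      exact hz.symm
    · rcases Finset.mem_insert.1 hv with rfl | hv
      · rw [Function.update_self]
        exact LinearPMap.mem_graph (T v) ⟨x', hx.1⟩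
      · rw [Function.update_of_ne (ne_of_mem_of_not_mem hv ha)]
        exact hyg v hv

/-- The vector `w` is the adjoint of `T` applied to `x`. -/
theorem exists_of_mem_graph_mulAdjoint [CompleteSpace E] {T : E →ₗ.[ℂ] E}
    (hT : Dense (T.domain : Set E)) {x y : E} (h : (x, y) ∈ (mulAdjoint T).graph) :
    ∃ w : E, inner ℂ x y = inner ℂ w w ∧
      ∀ f : T.domain, inner ℂ x (T f) = inner ℂ w (f : E) := by
  obtain ⟨⟨x', hx⟩, hxx, hy⟩ := (LinearPMap.mem_graph_iff _).1 h
  obtain rfl : x' = x := hxx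
  have hx : ∃ h : x' ∈ T.adjoint.domain, T.adjoint ⟨x', h⟩ ∈ T.domain := hx
  have hadj := T.adjoint_isFormalAdjoint hT
  have key : ∀ f : T.domain, inner ℂ x' (T f) = inner ℂ (T.adjoint ⟨x', hx.choose⟩) (f : E) :=
    fun f => (hadj ⟨x', hx.choose⟩ f).symm
  refine ⟨T.adjoint ⟨x', hx.choose⟩, ?_, key⟩
  obtain rfl : mulAdjoint T ⟨x', hx⟩ = y := hy
  exact key ⟨_, hx.choose_spec⟩

/-- A vector with vanishing expectation value of `∑ T_v T_v†` is orthogonal to the ranges of all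
the operators `T_v`. -/
theorem inner_eq_zero_of_sum_mulAdjoint [CompleteSpace E] {ι : Type*} (s : Finset ι)
    (T : ι → E →ₗ.[ℂ] E) (hT : ∀ v ∈ s, Dense ((T v).domain : Set E)) {x : E}
    (hx : x ∈ (∑ v ∈ s, mulAdjoint (T v)).domain)
    (h : inner ℂ x ((∑ v ∈ s, mulAdjoint (T v)) ⟨x, hx⟩) = 0) {v : ι} (hv : v ∈ s)
    (f : (T v).domain) : inner ℂ x (T v f) = 0 := by
  obtain ⟨y, hy, hyg⟩ := exists_of_mem_graph_sum s _
    (LinearPMap.mem_graph (∑ v ∈ s, mulAdjoint (T v)) ⟨x, hx⟩)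
  choose! w hw hwf using fun v hv => exists_of_mem_graph_mulAdjoint (hT v hv) (hyg v hv)
  have h0 : ∑ v ∈ s, ‖w v‖ ^ 2 = 0 := by
    rw [hy, inner_sum, Finset.sum_congr rfl hw] at h
    simp only [inner_self_eq_norm_sq_to_K] at h
    rw [← Complex.ofReal_inj]
    push_cast
    exact h
  have h1 := (Finset.sum_eq_zero_iff_of_nonneg fun v _ => sq_nonneg ‖w v‖).1 h0 v hv
  rw [hwf v hv, norm_eq_zero.1 (pow_eq_zero_iff two_ne_zero |>.1 h1), inner_zero_left]

variable {S : Type*} [TopologicalSpace S] [T2Space S] {C : EdgeCategory S}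
  {G : Type*} [Group G] [TopologicalSpace G] [IsTopologicalGroup G] [CompactSpace G]
  [SecondCountableTopology G] [MeasurableSpace G] [BorelSpace G]
  {μ : Measure (Conn C G)} [hμ : IsAshtekarLewandowski μ]

/-- Density of the domain makes Mathlib's adjoint of `H_v` on `H_γ` the true adjoint, not its junk
value. -/
theorem HamiltonConstraints.dense_domain_restrict (H : HamiltonConstraints μ) (γ : Graph C)
    (v : S) : Dense ((H.restrict γ v).domain : Set (Hgr μ γ)) := by
  refine Subtype.dense_iff.2 fun f hf => closure_mono ?_ (H.dense γ hf)
  rintro g ⟨hg, hgγ⟩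
  exact ⟨⟨g, hgγ⟩, hg, rfl⟩

theorem HamiltonConstraints.inner_op_eq_zero (H : HamiltonConstraints μ) {γ : Graph C}
    {Ψ : Hgr μ γ} (hΨ : Ψ ∈ (H.quadratic γ).domain)
    (hQ : inner ℂ Ψ (H.quadratic γ ⟨Ψ, hΨ⟩) = 0) {v : S} (hv : v ∈ γ.vertices) {f : H.dom}
    (hf : (f : Lp ℂ 2 μ) ∈ Hgr μ γ) : inner ℂ (Ψ : Lp ℂ 2 μ) (H.op (delta v) f) = 0 :=
  inner_eq_zero_of_sum_mulAdjoint γ.vertices (H.restrict γ)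
    (fun v _ => H.dense_domain_restrict γ v) hΨ hQ hv ⟨⟨f, hf⟩, f.2⟩

end Quadratic

end LQG

theorem proposition2 {S : Type*} [TopologicalSpace S] [T2Space S] {C : LQG.EdgeCategory S}
    {G : Type*} [Group G] [TopologicalSpace G] [IsTopologicalGroup G] [CompactSpace G] [T2Space G]
    [SecondCountableTopology G] [MeasurableSpace G] [BorelSpace G]
    (μ : Measure (LQG.Conn C G)) [LQG.IsAshtekarLewandowski μ]
    (γ₀ : LQG.Graph C) (hsym : γ₀.SymmetriesExtend) (hemb : γ₀.EmbeddingsAreSymmetries)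
    (H : LQG.HamiltonConstraints μ) (hcov : H.IsCovariant γ₀)
    (Ψ : LQG.Hgr μ γ₀) (hΨ : Ψ ∈ (H.quadratic γ₀).domain)
    (hQ : inner ℂ Ψ (H.quadratic γ₀ ⟨Ψ, hΨ⟩) = 0) :
    ∃ η : LQG.Graph C → Module.Dual ℂ (LQG.CylSpace μ),
      (∀ α ∈ γ₀.subgraphs, η α ∈ LQG.Hdiff μ ∧ LQG.IsRigged μ α (LQG.proj' μ α Ψ) (η α)) ∧
      ∀ (N : S → ℝ) (f : H.dom) (hf : (f : Lp ℂ 2 μ) ∈ LQG.Hgr μ γ₀),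
        (∑ α ∈ γ₀.subgraphs, (α.numEmbeddings γ₀ : ℂ)⁻¹ • η α)
          ⟨H.op N f, H.mem_cylSpace N hf⟩ = 0 := by
  have : ∀ γ : LQG.Graph C, Fintype γ.GS := fun γ => Fintype.ofFinite _
  have hη : ∀ α ∈ γ₀.subgraphs, ∃ L, L ∈ LQG.Hdiff μ ∧ LQG.IsRigged μ α (LQG.proj' μ α Ψ) L :=
    fun α hα => by
      have hα := LQG.Graph.mem_subgraphs.1 hα
      exact LQG.exists_isRigged ((hemb.finite hα).subset (LQG.Graph.embeddings_mono hα))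
        (LQG.proj'_mem α _)
  choose! η hη using hη
  refine ⟨η, hη, fun N f hf => ?_⟩
  -- On `H_γ₀`, the state is the average of `Ψ` over the symmetries of `γ₀`.
  have havg : (∑ α ∈ γ₀.subgraphs, (α.numEmbeddings γ₀ : ℂ)⁻¹ • η α)
      ⟨H.op N f, H.mem_cylSpace N hf⟩ = (Nat.card γ₀.GS : ℂ)⁻¹ *
        ∑ k : γ₀.GS, inner ℂ (LQG.U μ (k.out : γ₀.Diff) (Ψ : Lp ℂ 2 μ)) (H.op N f) := by
    rw [LinearMap.sum_apply]
    simp only [LinearMap.smul_apply, smul_eq_mul]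
    rw [Finset.sum_congr rfl fun α hα => (hη α hα).2.apply_eq hsym hemb
      (LQG.Graph.mem_subgraphs.1 hα) (LQG.proj'_mem α _) _ (H.graph_preserving N γ₀ f hf),
      ← Finset.mul_sum, Finset.sum_comm]
    congr 1
    refine Finset.sum_congr rfl fun k _ => ?_
    rw [← sum_inner, ← map_sum, LQG.sum_proj'_eq Ψ.2]
  rw [havg, Finset.sum_eq_zero, mul_zero]
  intro k _
  rw [H.vertex_sum N γ₀ f hf, inner_sum]
  refine Finset.sum_eq_zero fun v hv => ?_
  -- Covariance moves the symmetry from the state to the vertex and to `f`.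
  have hk : (k.out : C.diff)⁻¹ ∈ γ₀.Diff := γ₀.Diff.inv_mem k.out.2
  obtain ⟨hdom, heq⟩ := hcov _ hk v hv f hf
  rw [inner_smul_right, LQG.inner_U_left, ← heq,
    H.inner_op_eq_zero hΨ hQ (LQG.Graph.apply_mem_vertices hk hv)
      (LQG.U_mem_Hgr (LQG.Graph.image_arcs hk).subset hf), mul_zero]
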